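/- Let $k,\omega_0\in\mathbb R$, $\tau\ge 0$, $h>0$, and let $g(\omega)=\sqrt{h/\pi}\,e^{-h(\omega-\omega_0)^2}$ (also for complex $\omega$), $\mathcal H=L^2(\mathbb R,g(\omega)\,d\omega)$. Consider the delay equation $$u'(t)=i\mathcal M u(t)+\tfrac k2\,\mathcal P u(t-\tau)\quad\text{in }\mathcal H,\qquad (\mathcal M\psi)(\omega)=\omega\psi(\omega),\quad \mathcal P\psi=\int_{\mathbb R}\psi g\,d\omega\cdot\mathbb I,\quad \mathbb I\equiv 1 .$$ For $\beta\in\mathbb N$, $n\in\mathbb N^+$ let $\mathrm{Exp}(\beta,n)$ be the Banach space of the functions that are continuous on $\{\mathrm{Im}\,z\ge-1/n\}$, holomorphic in its interior, and of finite norm $\sup e^{-\beta|z|}|\psi(z)|$. Let $X=\mathrm{Exp}=\bigcup_{\beta,n}\mathrm{Exp}(\beta,n)$ with the locally convex inductive limit topology, and let $X'$ be the space of continuous linear functionals on $X$ with the weak dual topology. Let $\kappa:X\to X'$ be given by $\langle\kappa\psi|\varphi\rangle=\int\psi\varphi g\,d\omega$, let $\mathcal P^\times:X'\to X'$ be given by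 $\langle\mathcal P^\times u|\varphi\rangle=\langle u|\mathcal P\varphi\rangle$, and let $A(\lambda):\kappa X\to X'$, $\lambda\in\mathbb C$, be given by $$\langle A(\lambda)\kappa\psi|\varphi\rangle=\begin{cases}\int\frac{\psi\varphi g}{\lambda-i\omega}\,d\omega,&\mathrm{Re}\,\lambda>0,\\ \lim_{\varepsilon\to0+}\int\frac{\psi\varphi g}{\lambda+\varepsilon-i\omega}\,d\omega,&\mathrm{Re}\,\lambda=0,\\ \int\frac{\psi\varphi g}{\lambda-i\omega}\,d\omega+2\pi\,(\psi\varphi g)(\lambda/i),&\mathrm{Re}\,\lambda<0.\end{cases}$$ A number $\lambda$ is a generalized eigenvalue, $\lambda\in\hat\sigma_p$, if there is a nonzero $x\in\mathrm{Ran}\,A(\lambda)$ with $(\mathrm{id}-\frac k2e^{-\lambda\tau}A(\lambda)\mathcal P^\times)x=0$. If $\mathrm{id}-\frac k2e^{-\lambda\tau}\mathcal P^\times A(\lambda)$ is injective on $\kappa X$, put $\mathcal R_\tau(\lambda)=A(\lambda)(\mathrm{id}-\frac k2e^{-\lambda\tau}\mathcal P^\times A(\lambda))^{-1}$. The generalized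 resolvent set consists of all $\lambda$ with a neighborhood $V$ such that for every $\mu\in V$ the operator $\mathcal R_\tau(\mu)\kappa$ exists, is densely defined in $X$ and is continuous into $X'$, and such that $\{\mathcal R_\tau(\mu)\kappa\psi:\mu\in V\}$ is bounded in $X'$ for every $\psi\in X$; the generalized spectrum $\hat\sigma$ is its complement. The residual part $\hat\sigma_r$ is the set of all $\lambda$ for which $\mathcal R_\tau(\lambda)\kappa$ exists but is not densely defined, and $\hat\sigma_c=\hat\sigma\setminus(\hat\sigma_p\cup\hat\sigma_r)$. Then: (a) $\hat\sigma=\hat\sigma_p$ and $\hat\sigma_c=\hat\sigma_r=\emptyset$. (b) Let $\tau>0$, $\omega_0\ne0$, $k_c(\tau)=\frac2\tau\arccos(\cos(\omega_0\tau))-\frac\pi\tau$, and suppose that $|k|<|k_c(\tau)|$ and that $k$ does not have the opposite sign of $k_c(\tau)$ (i.e. $k\,k_c(\tau)\ge0$). Then there is $h^*>0$ such that for every $h>h^*$ all generalized eigenvalues have negative real part. -/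

import Mathlib

open Complex Filter Topology MeasureTheory Set

namespace DelayedKuramoto

/-! ## Generalized spectrum of a delay equation on a rigged space

`X` is a complex topological vector space and `X' = WeakDual ℂ X` its space of continuous linear
functionals with the weak dual topology.  The data are
* `kap : X → X'`, the canonical inclusion,
* `A z : X → X'`, which is the composition `A(z) ∘ kap` of the operator `A(z) : kap X → X'`
  (the continuation of the resolvent `(z - iH)⁻¹`) with the inclusion,
* `Kx : X' → X'`, the (bi)dual operator of the perturbation,
* `τ`, the delay. -/

section General

variable {X : Type*} [AddCommGroup X] [Module ℂ X] [TopologicalSpace X]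

/-- The dual operator `T' : X' → X'` of a continuous operator `T : X → X`, `⟨T' u | φ⟩ = ⟨u | T φ⟩`. -/
noncomputable def dualOp (T : X →L[ℂ] X) : WeakDual ℂ X →ₗ[ℂ] WeakDual ℂ X where
  toFun u := StrongDual.toWeakDual ((WeakDual.toStrongDual u).comp T)
  map_add' _ _ := rfl
  map_smul' _ _ := rfl

/-- The operator `(id - e^{-zτ} K^× A(z)) ∘ kap : X → X'`. -/
noncomputable def charOp (kap : X →ₗ[ℂ] WeakDual ℂ X) (A : ℂ → X →ₗ[ℂ] WeakDual ℂ X)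
    (Kx : WeakDual ℂ X →ₗ[ℂ] WeakDual ℂ X) (τ : ℝ) (z : ℂ) : X →ₗ[ℂ] WeakDual ℂ X :=
  kap - Complex.exp (-(z * τ)) • (Kx ∘ₗ A z)

/-- `z` is a generalized eigenvalue (resonance pole): there is a nonzero `x` in the range of `A(z)`
with `(id - e^{-zτ} A(z) K^×) x = 0`.  Since `A(z)` is defined on `kap X`, the vector `K^× x` has to
be of the form `kap ξ`. -/
def IsGenEigenvalue (kap : X →ₗ[ℂ] WeakDual ℂ X) (A : ℂ → X →ₗ[ℂ] WeakDual ℂ X)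
    (Kx : WeakDual ℂ X →ₗ[ℂ] WeakDual ℂ X) (τ : ℝ) (z : ℂ) : Prop :=
  ∃ x ∈ LinearMap.range (A z), x ≠ 0 ∧
    ∃ ξ : X, Kx x = kap ξ ∧ x - Complex.exp (-(z * τ)) • A z ξ = 0

/-- The set of generalized eigenvalues. -/
def genPointSpectrum (kap : X →ₗ[ℂ] WeakDual ℂ X) (A : ℂ → X →ₗ[ℂ] WeakDual ℂ X)
    (Kx : WeakDual ℂ X →ₗ[ℂ] WeakDual ℂ X) (τ : ℝ) : Set ℂ :=
  {z | IsGenEigenvalue kap A Kx τ z}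

/-- The domain of `R_τ(z) kap`, as a subspace of `X`: all `ψ` such that `kap ψ` lies in
`(id - e^{-zτ} K^× A(z)) (kap X)`. -/
noncomputable def resolventDomain (kap : X →ₗ[ℂ] WeakDual ℂ X) (A : ℂ → X →ₗ[ℂ] WeakDual ℂ X)
    (Kx : WeakDual ℂ X →ₗ[ℂ] WeakDual ℂ X) (τ : ℝ) (z : ℂ) : Submodule ℂ X :=
  (LinearMap.range (charOp kap A Kx τ z)).comap kap

/-- The generalized retarded resolvent
`R_τ(z) kap = A(z) ∘ (id - e^{-zτ} K^× A(z))⁻¹ ∘ kap`, with values in `X'`; it is defined when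
`id - e^{-zτ} K^× A(z)` is injective on `kap X`. -/
noncomputable def retardedResolvent (kap : X →ₗ[ℂ] WeakDual ℂ X)
    (A : ℂ → X →ₗ[ℂ] WeakDual ℂ X) (Kx : WeakDual ℂ X →ₗ[ℂ] WeakDual ℂ X) (τ : ℝ) (z : ℂ)
    (hinj : Function.Injective (charOp kap A Kx τ z)) :
    resolventDomain kap A Kx τ z →ₗ[ℂ] WeakDual ℂ X :=
  A z ∘ₗ (LinearEquiv.ofInjective (charOp kap A Kx τ z) hinj).symm.toLinearMap ∘ₗ
    kap.restrict (p := resolventDomain kap A Kx τ z)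
      (q := LinearMap.range (charOp kap A Kx τ z)) (fun _ hψ => hψ)

/-- The generalized resolvent set: `z` has a neighborhood `V` such that for every `μ ∈ V` the
operator `R_τ(μ) kap` exists, is densely defined and is continuous into `X'` with the weak dual
topology, and such that for every `ψ` the set of all `R_τ(μ) kap ψ`, `μ ∈ V`, is bounded in `X'`. -/
def genResolventSet (kap : X →ₗ[ℂ] WeakDual ℂ X) (A : ℂ → X →ₗ[ℂ] WeakDual ℂ X)
    (Kx : WeakDual ℂ X →ₗ[ℂ] WeakDual ℂ X) (τ : ℝ) : Set ℂ :=
  {z | ∃ V ∈ 𝓝 z,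
    (∀ μ ∈ V, ∃ hinj : Function.Injective (charOp kap A Kx τ μ),
      Dense (resolventDomain kap A Kx τ μ : Set X) ∧
      Continuous (retardedResolvent kap A Kx τ μ hinj)) ∧
    ∀ ψ : X, Bornology.IsVonNBounded ℂ
      {u : WeakDual ℂ X | ∃ μ ∈ V, ∃ hinj : Function.Injective (charOp kap A Kx τ μ),
        ∃ hψ : ψ ∈ resolventDomain kap A Kx τ μ, u = retardedResolvent kap A Kx τ μ hinj ⟨ψ, hψ⟩}}

/-- The generalized spectrum. -/
def genSpectrum (kap : X →ₗ[ℂ] WeakDual ℂ X) (A : ℂ → X →ₗ[ℂ] WeakDual ℂ X)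
    (Kx : WeakDual ℂ X →ₗ[ℂ] WeakDual ℂ X) (τ : ℝ) : Set ℂ :=
  (genResolventSet kap A Kx τ)ᶜ

/-- The generalized residual spectrum: `R_τ(z) kap` exists, but its domain is not dense. -/
def genResidualSpectrum (kap : X →ₗ[ℂ] WeakDual ℂ X) (A : ℂ → X →ₗ[ℂ] WeakDual ℂ X)
    (Kx : WeakDual ℂ X →ₗ[ℂ] WeakDual ℂ X) (τ : ℝ) : Set ℂ :=
  {z | Function.Injective (charOp kap A Kx τ z) ∧
    ¬ Dense (resolventDomain kap A Kx τ z : Set X)}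

/-- The generalized continuous spectrum: the remainder of the generalized spectrum. -/
def genContinuousSpectrum (kap : X →ₗ[ℂ] WeakDual ℂ X) (A : ℂ → X →ₗ[ℂ] WeakDual ℂ X)
    (Kx : WeakDual ℂ X →ₗ[ℂ] WeakDual ℂ X) (τ : ℝ) : Set ℂ :=
  genSpectrum kap A Kx τ \ (genPointSpectrum kap A Kx τ ∪ genResidualSpectrum kap A Kx τ)

end General

/-! ## The space `Exp` -/

/-- The closed half-plane `Im z ≥ -1/n`. -/
abbrev HalfPlane (n : ℕ+) : Type := {z : ℂ // -(1 / (n : ℝ)) ≤ z.im}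

/-- The closed upper half-plane. -/
abbrev UpperClosed : Type := {z : ℂ // 0 ≤ z.im}

/-- The functions on `Im z ≥ -1/n` that are continuous, holomorphic in the interior, and for which
`e^{-β|z|} |ψ z|` is bounded. -/
def expStepSubmodule (β : ℕ) (n : ℕ+) : Submodule ℂ (HalfPlane n → ℂ) where
  carrier := {f | (∃ F : ℂ → ℂ, DiffContOnCl ℂ F {z | -(1 / (n : ℝ)) < z.im} ∧
      ∀ z : HalfPlane n, F z = f z) ∧
    BddAbove (range fun z : HalfPlane n => Real.exp (-(β * ‖(z : ℂ)‖)) * ‖f z‖)}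
  zero_mem' := by
    refine ⟨⟨0, diffContOnCl_const, fun _ => rfl⟩, ⟨0, ?_⟩⟩
    rintro _ ⟨z, rfl⟩
    simp
  add_mem' := by
    rintro f g ⟨⟨F, hF, hFf⟩, ⟨a, ha⟩⟩ ⟨⟨G, hG, hGg⟩, ⟨b, hb⟩⟩
    refine ⟨⟨F + G, hF.add hG, fun z => by simp [hFf, hGg]⟩, ⟨a + b, ?_⟩⟩
    rintro _ ⟨z, rfl⟩
    have h1 := ha ⟨z, rfl⟩
    have h2 := hb ⟨z, rfl⟩
    have h3 := norm_add_le (f z) (g z)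
    have h4 := Real.exp_pos (-(β * ‖(z : ℂ)‖))
    simp only [Pi.add_apply] at *
    nlinarith
  smul_mem' := by
    rintro c f ⟨⟨F, hF, hFf⟩, ⟨a, ha⟩⟩
    refine ⟨⟨c • F, hF.const_smul c, fun z => by simp [hFf]⟩, ⟨‖c‖ * a, ?_⟩⟩
    rintro _ ⟨z, rfl⟩
    have h1 := ha ⟨z, rfl⟩
    simp only [Pi.smul_apply, smul_eq_mul, norm_mul] at *
    nlinarith [norm_nonneg c]

/-- The Banach space `Exp(β, n)`. -/
def ExpStep (β : ℕ) (n : ℕ+) : Type := ↥(expStepSubmodule β n)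

instance (β : ℕ) (n : ℕ+) : AddCommGroup (ExpStep β n) :=
  inferInstanceAs (AddCommGroup ↥(expStepSubmodule β n))

instance (β : ℕ) (n : ℕ+) : Module ℂ (ExpStep β n) :=
  inferInstanceAs (Module ℂ ↥(expStepSubmodule β n))

/-- The norm `sup e^{-β|z|} |ψ z|` over `Im z ≥ -1/n`. -/
noncomputable instance (β : ℕ) (n : ℕ+) : Norm (ExpStep β n) where
  norm f := ⨆ z : HalfPlane n, Real.exp (-(β * ‖(z : ℂ)‖)) * ‖f.1 z‖

lemma ExpStep.norm_def {β : ℕ} {n : ℕ+} (f : ExpStep β n) :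
    ‖f‖ = ⨆ z : HalfPlane n, Real.exp (-(β * ‖(z : ℂ)‖)) * ‖f.1 z‖ := rfl

lemma ExpStep.le_norm {β : ℕ} {n : ℕ+} (f : ExpStep β n) (z : HalfPlane n) :
    Real.exp (-(β * ‖(z : ℂ)‖)) * ‖f.1 z‖ ≤ ‖f‖ :=
  le_ciSup f.2.2 z

lemma ExpStep.norm_nonneg' {β : ℕ} {n : ℕ+} (f : ExpStep β n) : 0 ≤ ‖f‖ :=
  Real.iSup_nonneg fun _ => by positivity

lemma ExpStep.norm_apply_le {β : ℕ} {n : ℕ+} (f : ExpStep β n) (z : HalfPlane n) :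
    ‖f.1 z‖ ≤ ‖f‖ * Real.exp (β * ‖(z : ℂ)‖) := by
  have h := f.le_norm z
  rw [Real.exp_neg, inv_mul_le_iff₀ (Real.exp_pos _)] at h
  linarith

instance (n : ℕ+) : Nonempty (HalfPlane n) := ⟨⟨0, by simp⟩⟩

lemma ExpStep.normCore (β : ℕ) (n : ℕ+) : NormedSpace.Core ℂ (ExpStep β n) where
  norm_nonneg := ExpStep.norm_nonneg'
  norm_smul c f := by
    have h : ∀ z : HalfPlane n, Real.exp (-(β * ‖(z : ℂ)‖)) * ‖(c • f).1 z‖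
        = ‖c‖ * (Real.exp (-(β * ‖(z : ℂ)‖)) * ‖f.1 z‖) := by
      intro z
      have : (c • f).1 z = c * f.1 z := rfl
      rw [this, norm_mul]; ring
    rw [ExpStep.norm_def, ExpStep.norm_def, Real.mul_iSup_of_nonneg (norm_nonneg c)]
    simp only [h]
  norm_triangle f g := by
    refine ciSup_le fun z => ?_
    have h1 := f.le_norm z
    have h2 := g.le_norm z
    have h3 := norm_add_le (f.1 z) (g.1 z)
    have h4 := Real.exp_pos (-(β * ‖(z : ℂ)‖))
    have h5 : (f + g).1 z = f.1 z + g.1 z := rfl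
    rw [h5]
    nlinarith
  norm_eq_zero_iff f := by
    constructor
    · intro h
      apply Subtype.ext
      funext z
      have := f.norm_apply_le z
      rw [h, zero_mul] at this
      exact norm_le_zero_iff.1 this
    · rintro rfl
      have h : ∀ z : HalfPlane n, Real.exp (-(β * ‖(z : ℂ)‖)) * ‖(0 : ExpStep β n).1 z‖ = 0 := by
        intro z
        have : (0 : ExpStep β n).1 z = 0 := rfl
        rw [this]; simp
      rw [ExpStep.norm_def]
      simp only [h]
      simp

noncomputable instance (β : ℕ) (n : ℕ+) : NormedAddCommGroup (ExpStep β n) :=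
  NormedAddCommGroup.ofCore (ExpStep.normCore β n)

noncomputable instance (β : ℕ) (n : ℕ+) : NormedSpace ℂ (ExpStep β n) :=
  NormedSpace.ofCore (ExpStep.normCore β n)

/-- A point of the closed upper half-plane as a point of `Im z ≥ -1/n`. -/
def UpperClosed.toHalfPlane (n : ℕ+) (z : UpperClosed) : HalfPlane n :=
  ⟨z.1, le_trans (by simp) z.2⟩

/-- Restriction of a function on `Im z ≥ -1/n` to the closed upper half-plane.  By the identity
theorem it is injective on the holomorphic functions. -/
def restrictUpper (n : ℕ+) : (HalfPlane n → ℂ) →ₗ[ℂ] (UpperClosed → ℂ) :=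
  LinearMap.funLeft ℂ ℂ (UpperClosed.toHalfPlane n)

lemma expStep_mono {β β' : ℕ} {n n' : ℕ+} (hβ : β ≤ β') (hn : n ≤ n') {f : UpperClosed → ℂ}
    (hf : f ∈ (expStepSubmodule β n).map (restrictUpper n)) :
    f ∈ (expStepSubmodule β' n').map (restrictUpper n') := by
  obtain ⟨g, ⟨⟨F, hF, hFg⟩, ⟨a, ha⟩⟩, rfl⟩ := hf
  have hnn : (1 / (n' : ℝ)) ≤ 1 / (n : ℝ) := by
    apply one_div_le_one_div_of_le
    · exact_mod_cast n.pos
    · exact_mod_cast hn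
  refine ⟨fun z => g ⟨z.1, by linarith [z.2]⟩, ⟨⟨F, ?_, fun z => hFg ⟨z.1, by linarith [z.2]⟩⟩,
    ⟨a, ?_⟩⟩, rfl⟩
  · exact hF.mono fun z hz => by exact lt_of_le_of_lt (neg_le_neg hnn) hz
  · rintro _ ⟨z, rfl⟩
    refine le_trans ?_ (ha ⟨⟨z.1, by linarith [z.2]⟩, rfl⟩)
    have hb : (β : ℝ) ≤ β' := by exact_mod_cast hβ
    dsimp only
    gcongr

/-- `Exp = ⋃ β, ⋃ n, Exp(β, n)`, realized as a space of functions on the closed upper half-plane. -/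
def expSubmodule : Submodule ℂ (UpperClosed → ℂ) where
  carrier := ⋃ (β : ℕ) (n : ℕ+), ((expStepSubmodule β n).map (restrictUpper n) : Set _)
  zero_mem' := by
    simp only [mem_iUnion]
    exact ⟨0, 1, Submodule.zero_mem _⟩
  add_mem' := by
    simp only [mem_iUnion]
    rintro f g ⟨β, n, hf⟩ ⟨β', n', hg⟩
    exact ⟨max β β', max n n', Submodule.add_mem _
      (expStep_mono (le_max_left _ _) (le_max_left _ _) hf)
      (expStep_mono (le_max_right _ _) (le_max_right _ _) hg)⟩
  smul_mem' := by
    simp only [mem_iUnion]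
    rintro c f ⟨β, n, hf⟩
    exact ⟨β, n, Submodule.smul_mem _ c hf⟩

/-- The space `Exp` of functions holomorphic in a neighborhood `Im z > -1/n` of the closed upper
half-plane that grow at most exponentially. -/
def Exp : Type := ↥expSubmodule

instance : AddCommGroup Exp := inferInstanceAs (AddCommGroup ↥expSubmodule)

instance : Module ℂ Exp := inferInstanceAs (Module ℂ ↥expSubmodule)

/-- The inclusion `Exp(β, n) → Exp`. -/
def Exp.incl (β : ℕ) (n : ℕ+) : ExpStep β n →ₗ[ℂ] Exp where
  toFun f := ⟨restrictUpper n f.1, mem_iUnion.2 ⟨β, mem_iUnion.2 ⟨n, f.1, f.2, rfl⟩⟩⟩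
  map_add' _ _ := rfl
  map_smul' _ _ := rfl

lemma Exp.exists_incl (ψ : Exp) : ∃ (β : ℕ) (n : ℕ+) (f : ExpStep β n), Exp.incl β n f = ψ := by
  obtain ⟨f, hf⟩ := ψ
  have hf' := hf
  change f ∈ ⋃ (β : ℕ) (n : ℕ+), ((expStepSubmodule β n).map (restrictUpper n) : Set _) at hf'
  simp only [mem_iUnion] at hf'
  obtain ⟨β, n, g, hg, rfl⟩ := hf'
  exact ⟨β, n, ⟨g, hg⟩, rfl⟩

/-- The topology of `Exp`: the locally convex inductive limit topology, i.e. the finest locally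
convex vector space topology for which all inclusions `Exp(β, n) → Exp` are continuous. -/
instance : TopologicalSpace Exp :=
  sInf {t : TopologicalSpace Exp |
    @IsTopologicalAddGroup Exp t _ ∧ @ContinuousSMul ℂ Exp _ _ t ∧
    @LocallyConvexSpace ℝ Exp _ _ _ _ t ∧
    ∀ (β : ℕ) (n : ℕ+), @Continuous (ExpStep β n) Exp _ t (Exp.incl β n)}

instance : IsTopologicalAddGroup Exp := topologicalAddGroup_sInf fun _ ht => ht.1

instance : ContinuousSMul ℂ Exp := continuousSMul_sInf fun _ ht => ht.2.1

instance : LocallyConvexSpace ℝ Exp := .sInf fun _ ht => ht.2.2.1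

/-- A linear functional on `Exp` that is bounded on every step `Exp(β, n)` is continuous. -/
lemma Exp.continuous_of_bound (u : Exp →ₗ[ℂ] ℂ)
    (hu : ∀ (β : ℕ) (n : ℕ+), ∃ C : ℝ, ∀ f : ExpStep β n, ‖u (Exp.incl β n f)‖ ≤ C * ‖f‖) :
    Continuous u := by
  rw [continuous_iff_le_induced]
  refine sInf_le ⟨topologicalAddGroup_induced u, continuousSMul_induced u,
    LocallyConvexSpace.induced (u.restrictScalars ℝ), fun β n => ?_⟩
  rw [continuous_induced_rng]
  obtain ⟨C, hC⟩ := hu β n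
  exact (LinearMap.mkContinuous (u ∘ₗ Exp.incl β n) C hC).continuous

/-- The element of `Exp'` given by a linear functional bounded on every step. -/
noncomputable def Exp.mkDual (u : Exp →ₗ[ℂ] ℂ)
    (hu : ∀ (β : ℕ) (n : ℕ+), ∃ C : ℝ, ∀ f : ExpStep β n, ‖u (Exp.incl β n f)‖ ≤ C * ‖f‖) :
    WeakDual ℂ Exp :=
  StrongDual.toWeakDual ⟨u, Exp.continuous_of_bound u hu⟩

/-- The value `ψ(z)` of `ψ ∈ Exp` at a point of the closed upper half-plane.  (It is only used for
`Im z ≥ 0`; for other `z` it is set to be `0`.) -/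
noncomputable def Exp.ev (z : ℂ) : Exp →ₗ[ℂ] ℂ where
  toFun ψ := if hz : 0 ≤ z.im then ψ.1 ⟨z, hz⟩ else 0
  map_add' ψ φ := by
    split_ifs
    · rfl
    · simp
  map_smul' c ψ := by
    split_ifs
    · rfl
    · simp

/-- The constant function `1` as an element of `Exp(0, 1)`. -/
def ExpStep.one : ExpStep 0 1 :=
  ⟨fun _ => 1, ⟨fun _ => 1, diffContOnCl_const, fun _ => rfl⟩, ⟨1, by
    rintro _ ⟨z, rfl⟩
    simp⟩⟩

/-- The constant function `𝟙 ∈ Exp`. -/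
def Exp.one : Exp := Exp.incl 0 1 ExpStep.one

lemma Exp.ev_incl {β : ℕ} {n : ℕ+} (f : ExpStep β n) {z : ℂ} (hz : 0 ≤ z.im) :
    Exp.ev z (Exp.incl β n f) = f.1 (UpperClosed.toHalfPlane n ⟨z, hz⟩) := by
  simp only [Exp.ev, LinearMap.coe_mk, AddHom.coe_mk, dif_pos hz]
  rfl

lemma Exp.norm_ev_incl_le {β : ℕ} {n : ℕ+} (f : ExpStep β n) {z : ℂ} (hz : 0 ≤ z.im) :
    ‖Exp.ev z (Exp.incl β n f)‖ ≤ ‖f‖ * Real.exp (β * ‖z‖) := by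
  rw [Exp.ev_incl f hz]
  exact f.norm_apply_le _

lemma Exp.continuous_ev (ψ : Exp) : Continuous fun ω : ℝ => Exp.ev (ω : ℂ) ψ := by
  obtain ⟨β, n, f, rfl⟩ := ψ.exists_incl
  obtain ⟨F, hF, hFf⟩ := f.2.1
  have h : (fun ω : ℝ => Exp.ev (ω : ℂ) (Exp.incl β n f)) = fun ω : ℝ => F (ω : ℂ) := by
    funext ω
    rw [Exp.ev_incl f (by simp)]
    exact (hFf _).symm
  rw [h]
  have hcont : ContinuousOn F {z | -(1 / (n : ℝ)) < z.im} := hF.differentiableOn.continuousOn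
  exact hcont.comp_continuous Complex.continuous_ofReal fun ω => by simp

/-! ## The Gaussian density and the operators -/

/-- The Gaussian density `g(ω) = √(h/π) e^{-h(ω-ω₀)²}`, as an entire function. -/
noncomputable def gauss (ω₀ h : ℝ) (z : ℂ) : ℂ :=
  (Real.sqrt (h / Real.pi) : ℂ) * Complex.exp (-h * (z - ω₀) ^ 2)

lemma integrable_weight (ω₀ : ℝ) {h : ℝ} (hh : 0 < h) (B : ℝ) :
    Integrable fun ω : ℝ => Real.exp (B * |ω|) * ‖gauss ω₀ h (ω : ℂ)‖ := by
  have key : ∀ b : ℝ, Integrable fun ω : ℝ => Real.exp (b * ω) * ‖gauss ω₀ h (ω : ℂ)‖ := by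
    intro b
    have h1 := (integrable_cexp_quadratic' (b := (-h : ℂ)) (by simpa using hh)
      (2 * h * ω₀ + b) (-h * ω₀ ^ 2)).norm.const_mul (Real.sqrt (h / Real.pi))
    refine h1.congr (Eventually.of_forall fun ω => ?_)
    simp only [gauss, norm_mul, Complex.norm_real, Real.norm_eq_abs,
      abs_of_nonneg (Real.sqrt_nonneg _)]
    have h2 : Complex.exp (-(h : ℂ) * (ω : ℂ) ^ 2 + (2 * h * ω₀ + b) * ω + -h * ω₀ ^ 2)
        = ((Real.exp (b * ω) : ℝ) : ℂ) * Complex.exp (-h * ((ω : ℂ) - ω₀) ^ 2) := by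
      rw [Complex.ofReal_exp, ← Complex.exp_add]
      congr 1
      push_cast
      ring
    rw [h2, norm_mul, Complex.norm_real, Real.norm_eq_abs, abs_of_pos (Real.exp_pos _)]
    ring
  have hc : Continuous fun ω : ℝ => Real.exp (B * |ω|) * ‖gauss ω₀ h (ω : ℂ)‖ := by
    unfold gauss
    fun_prop
  refine ((key B).add (key (-B))).mono' hc.aestronglyMeasurable (Eventually.of_forall fun ω => ?_)
  rw [Real.norm_eq_abs, abs_of_nonneg (by positivity)]
  simp only [Pi.add_apply]
  rw [← add_mul]
  refine mul_le_mul_of_nonneg_right ?_ (norm_nonneg _)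
  rcases abs_cases ω with ⟨h1, _⟩ | ⟨h1, _⟩ <;> rw [h1]
  · linarith [Real.exp_pos (-B * ω)]
  · have : B * -ω = -B * ω := by ring
    rw [this]
    linarith [Real.exp_pos (B * ω)]

lemma gauss_continuous (ω₀ h : ℝ) : Continuous (gauss ω₀ h) := by
  unfold gauss
  fun_prop

lemma integrable_prod (ω₀ : ℝ) {h : ℝ} (hh : 0 < h) (ψ φ : Exp) :
    Integrable fun ω : ℝ => Exp.ev (ω : ℂ) ψ * Exp.ev (ω : ℂ) φ * gauss ω₀ h (ω : ℂ) := by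
  obtain ⟨β, n, f, rfl⟩ := ψ.exists_incl
  obtain ⟨β', n', f', rfl⟩ := φ.exists_incl
  refine ((integrable_weight ω₀ hh (β + β')).const_mul (‖f‖ * ‖f'‖)).mono' ?_
    (Eventually.of_forall fun ω => ?_)
  · exact (((Exp.continuous_ev _).mul (Exp.continuous_ev _)).mul
      ((gauss_continuous ω₀ h).comp Complex.continuous_ofReal)).aestronglyMeasurable
  · have h1 := Exp.norm_ev_incl_le f (z := (ω : ℂ)) (by simp)
    have h2 := Exp.norm_ev_incl_le f' (z := (ω : ℂ)) (by simp)
    rw [Complex.norm_real, Real.norm_eq_abs] at h1 h2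
    rw [norm_mul, norm_mul]
    calc _ ≤ (‖f‖ * Real.exp (β * |ω|)) * (‖f'‖ * Real.exp (β' * |ω|)) * ‖gauss ω₀ h (ω : ℂ)‖ := by
          gcongr
      _ = _ := by rw [add_mul, Real.exp_add]; ring

/-- The integral of `|ψ φ g|` is bounded by a multiple of the norm of `φ`. -/
lemma integral_norm_prod_le (ω₀ : ℝ) {h : ℝ} (hh : 0 < h) (ψ : Exp) (β : ℕ) (n : ℕ+) :
    ∃ C : ℝ, ∀ f : ExpStep β n,
      ∫ ω : ℝ, ‖Exp.ev (ω : ℂ) ψ * Exp.ev (ω : ℂ) (Exp.incl β n f) * gauss ω₀ h (ω : ℂ)‖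
        ≤ C * ‖f‖ := by
  obtain ⟨β', n', f', rfl⟩ := ψ.exists_incl
  refine ⟨‖f'‖ * ∫ ω : ℝ, Real.exp ((β + β') * |ω|) * ‖gauss ω₀ h (ω : ℂ)‖, fun f => ?_⟩
  calc _ ≤ ∫ ω : ℝ, (‖f‖ * ‖f'‖) * (Real.exp ((β + β') * |ω|) * ‖gauss ω₀ h (ω : ℂ)‖) := by
        refine integral_mono (integrable_prod ω₀ hh _ _).norm
          ((integrable_weight ω₀ hh (β + β')).const_mul _) fun ω => ?_
        have h1 := Exp.norm_ev_incl_le f (z := (ω : ℂ)) (by simp)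
        have h2 := Exp.norm_ev_incl_le f' (z := (ω : ℂ)) (by simp)
        rw [Complex.norm_real, Real.norm_eq_abs] at h1 h2
        dsimp only
        rw [norm_mul, norm_mul]
        calc _ ≤ (‖f'‖ * Real.exp (β' * |ω|)) * (‖f‖ * Real.exp (β * |ω|))
                * ‖gauss ω₀ h (ω : ℂ)‖ := by gcongr
          _ = _ := by rw [add_mul, Real.exp_add]; ring
    _ = _ := by rw [integral_const_mul]; ring

/-- The canonical inclusion `kap : Exp → Exp'`, `⟨kap ψ | φ⟩ = ∫ ψ(ω) φ(ω) g(ω) dω`, given by the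
(bilinear) pairing of `L²(ℝ, g dω)`. -/
noncomputable def kappa (ω₀ : ℝ) {h : ℝ} (hh : 0 < h) : Exp →ₗ[ℂ] WeakDual ℂ Exp where
  toFun ψ := Exp.mkDual
    { toFun := fun φ => ∫ ω : ℝ, Exp.ev (ω : ℂ) ψ * Exp.ev (ω : ℂ) φ * gauss ω₀ h (ω : ℂ)
      map_add' := fun φ φ' => by
        rw [← integral_add (integrable_prod ω₀ hh ψ φ) (integrable_prod ω₀ hh ψ φ')]
        congr 1; funext ω; rw [map_add]; ring
      map_smul' := fun c φ => by
        rw [RingHom.id_apply, smul_eq_mul, ← integral_const_mul]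
        congr 1; funext ω; rw [map_smul, smul_eq_mul]; ring }
    (fun β n => by
      obtain ⟨C, hC⟩ := integral_norm_prod_le ω₀ hh ψ β n
      exact ⟨C, fun f => (norm_integral_le_integral_norm _).trans (hC f)⟩)
  map_add' ψ ψ' := by
    refine DFunLike.ext _ _ fun φ => ?_
    change ∫ ω : ℝ, Exp.ev (ω : ℂ) (ψ + ψ') * Exp.ev (ω : ℂ) φ * gauss ω₀ h (ω : ℂ)
      = (∫ ω : ℝ, Exp.ev (ω : ℂ) ψ * Exp.ev (ω : ℂ) φ * gauss ω₀ h (ω : ℂ))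
        + ∫ ω : ℝ, Exp.ev (ω : ℂ) ψ' * Exp.ev (ω : ℂ) φ * gauss ω₀ h (ω : ℂ)
    rw [← integral_add (integrable_prod ω₀ hh ψ φ) (integrable_prod ω₀ hh ψ' φ)]
    congr 1; funext ω; rw [map_add]; ring
  map_smul' c ψ := by
    refine DFunLike.ext _ _ fun φ => ?_
    change ∫ ω : ℝ, Exp.ev (ω : ℂ) (c • ψ) * Exp.ev (ω : ℂ) φ * gauss ω₀ h (ω : ℂ)
      = c * ∫ ω : ℝ, Exp.ev (ω : ℂ) ψ * Exp.ev (ω : ℂ) φ * gauss ω₀ h (ω : ℂ)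
    rw [← integral_const_mul]
    congr 1; funext ω; rw [map_smul, smul_eq_mul]; ring

/-- The operator `K = (k/2) P` on `Exp`, where `P φ = (∫ φ(ω) g(ω) dω) 𝟙`. -/
noncomputable def couplingOp (k ω₀ : ℝ) {h : ℝ} (hh : 0 < h) : Exp →L[ℂ] Exp :=
  ((k / 2 : ℝ) : ℂ) • (WeakDual.toStrongDual (kappa ω₀ hh Exp.one)).smulRight Exp.one

lemma Exp.ev_one {z : ℂ} (hz : 0 ≤ z.im) : Exp.ev z Exp.one = 1 := by
  exact Exp.ev_incl ExpStep.one hz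

lemma couplingOp_apply (k ω₀ : ℝ) {h : ℝ} (hh : 0 < h) (φ : Exp) :
    couplingOp k ω₀ hh φ =
      ((k / 2 : ℝ) : ℂ) • (∫ ω : ℝ, Exp.ev (ω : ℂ) φ * gauss ω₀ h (ω : ℂ)) • Exp.one := by
  change ((k / 2 : ℝ) : ℂ) • (∫ ω : ℝ, Exp.ev (ω : ℂ) Exp.one * Exp.ev (ω : ℂ) φ
    * gauss ω₀ h (ω : ℂ)) • Exp.one = _
  congr 3
  funext ω
  rw [Exp.ev_one (by simp), one_mul]

/-- Integral of the Cauchy kernel over a symmetric interval. -/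
lemma tendsto_kernel_interval (y : ℝ) {ρ : ℝ} (hρ : 0 < ρ) :
    Tendsto (fun ε : ℝ => ∫ ω in (y - ρ)..(y + ρ), ((y : ℂ) * I + ε - I * ω)⁻¹) (𝓝[>] 0)
      (𝓝 (Real.pi : ℂ)) := by
  have h1 : ∀ ε : ℝ, 0 < ε → ∫ ω in (y - ρ)..(y + ρ), ((y : ℂ) * I + ε - I * ω)⁻¹
      = I * Complex.log (ε - I * ρ) - I * Complex.log (ε + I * ρ) := by
    intro ε hε
    have hd : ∀ x ∈ uIcc (y - ρ) (y + ρ), HasDerivAt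
        (fun ω : ℝ => I * Complex.log ((y : ℂ) * I + ε - I * ω))
        (((y : ℂ) * I + ε - I * x)⁻¹) x := by
      intro x _
      have hs : (y : ℂ) * I + ε - I * x ∈ slitPlane := Or.inl (by simpa using hε)
      have h2 : HasDerivAt (fun ω : ℝ => (y : ℂ) * I + ε - I * ω) (-I) x := by
        have := ((Complex.ofRealCLM.hasDerivAt (x := x)).const_mul I).const_sub ((y : ℂ) * I + ε)
        simpa using this
      have h3 := (h2.clog_real hs).const_mul I
      have h4 : I * (-I / ((y : ℂ) * I + ε - I * x)) = ((y : ℂ) * I + ε - I * x)⁻¹ := by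
        rw [div_eq_mul_inv, ← mul_assoc]
        simp
      rw [h4] at h3
      exact h3
    rw [intervalIntegral.integral_eq_sub_of_hasDerivAt hd]
    · congr 3 <;> push_cast <;> ring
    · apply ContinuousOn.intervalIntegrable
      intro x _
      have : (y : ℂ) * I + ε - I * x ≠ 0 := by
        intro h
        have := congrArg Complex.re h
        simp at this
        linarith
      apply ContinuousAt.continuousWithinAt
      have hc : ContinuousAt (fun ω : ℝ => (y : ℂ) * I + ε - I * ω) x := by fun_prop
      exact hc.inv₀ this
  have h4 : (Real.pi : ℂ) = I * Complex.log ((0 : ℝ) - I * ρ) - I * Complex.log ((0 : ℝ) + I * ρ) := by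
    have e1 : ((0 : ℝ) : ℂ) - I * ρ = ((ρ : ℝ) : ℂ) * (-I) := by push_cast; ring
    have e2 : ((0 : ℝ) : ℂ) + I * ρ = ((ρ : ℝ) : ℂ) * I := by push_cast; ring
    rw [e1, e2, Complex.log_ofReal_mul hρ (by simp), Complex.log_ofReal_mul hρ (by simp),
      Complex.log_neg_I, Complex.log_I]
    ring_nf
    simp
  rw [h4]
  refine Tendsto.congr' (f₁ := fun ε : ℝ => I * Complex.log (ε - I * ρ)
    - I * Complex.log (ε + I * ρ)) ?_ ?_
  · filter_upwards [self_mem_nhdsWithin] with ε hε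
    exact (h1 ε hε).symm
  · have c1 : ContinuousAt (fun ε : ℝ => Complex.log ((ε : ℂ) - I * ρ)) 0 :=
      ContinuousAt.clog (by fun_prop) (Or.inr (by simpa using hρ.ne'))
    have c2 : ContinuousAt (fun ε : ℝ => Complex.log ((ε : ℂ) + I * ρ)) 0 :=
      ContinuousAt.clog (by fun_prop) (Or.inr (by simpa using hρ.ne'))
    exact (((c1.const_mul I).sub (c2.const_mul I)).tendsto).mono_left nhdsWithin_le_nhds

lemma exists_boundary_limit {f : ℝ → ℂ} (hf : Integrable f) (y : ℝ) {ρ C : ℝ} (hρ : 0 < ρ)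
    (hC0 : 0 ≤ C) (hC : ∀ ω : ℝ, |ω - y| ≤ ρ → ‖f ω - f y‖ ≤ C * |ω - y|) :
    ∃ L : ℂ, Tendsto (fun ε : ℝ => ∫ ω : ℝ, ((y : ℂ) * I + ε - I * ω)⁻¹ * f ω) (𝓝[>] 0) (𝓝 L) ∧
      ‖L‖ ≤ Real.pi * ‖f y‖ + (2 * ρ * C + (1 / ρ) * ∫ ω : ℝ, ‖f ω‖) := by
  set S : Set ℝ := Icc (y - ρ) (y + ρ) with hS
  have hSm : MeasurableSet S := measurableSet_Icc
  have hmem : ∀ ω, ω ∈ S ↔ |ω - y| ≤ ρ := by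
    intro ω; rw [hS, mem_Icc, abs_le]; constructor <;> rintro ⟨a, b⟩ <;> constructor <;> linarith
  set s : ℝ → ℂ := fun ω => f ω - S.indicator (fun _ => f y) ω with hs
  have hind : Integrable (S.indicator fun _ : ℝ => f y) :=
    (integrable_indicator_iff hSm).2 (by simp [hS])
  have hsi : Integrable s := hf.sub hind
  set bnd : ℝ → ℝ := fun ω => S.indicator (fun _ => C) ω + (1 / ρ) * ‖f ω‖ with hbnd
  have hbi : Integrable bnd := by
    refine Integrable.add ?_ (hf.norm.const_mul _)
    exact (integrable_indicator_iff hSm).2 (by simp [hS])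
  -- the remainder is bounded by `bnd ω * |ω - y|`
  have hsb : ∀ ω, ‖s ω‖ ≤ bnd ω * |ω - y| := by
    intro ω
    by_cases hω : ω ∈ S
    · simp only [hs, hbnd, indicator_of_mem hω]
      have := hC ω ((hmem ω).1 hω)
      have h2 : 0 ≤ 1 / ρ * ‖f ω‖ * |ω - y| := by positivity
      nlinarith
    · simp only [hs, hbnd, indicator_of_notMem hω, sub_zero, zero_add]
      have h1 : ρ ≤ |ω - y| := by
        by_contra h
        exact hω ((hmem ω).2 (le_of_not_ge h))
      have h2 : 1 ≤ (1 / ρ) * |ω - y| := by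
        rw [one_div, inv_mul_eq_div, one_le_div hρ]; exact h1
      nlinarith [norm_nonneg (f ω)]
  have hker : ∀ ε ω : ℝ, ‖(y : ℂ) * I + ε - I * ω‖ ≥ |ω - y| := by
    intro ε ω
    have := Complex.abs_im_le_norm ((y : ℂ) * I + ε - I * ω)
    simp at this
    rw [abs_sub_comm]; exact this
  have hker2 : ∀ ε ω : ℝ, ‖((y : ℂ) * I + ε - I * ω)⁻¹ * s ω‖ ≤ bnd ω := by
    intro ε ω
    have hb0 : 0 ≤ bnd ω := by
      simp only [hbnd]
      have : 0 ≤ S.indicator (fun _ => C) ω := indicator_nonneg (fun _ _ => hC0) _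
      positivity
    rw [norm_mul, norm_inv]
    rcases eq_or_lt_of_le (norm_nonneg ((y : ℂ) * I + ε - I * ω)) with h | h
    · rw [← h]; simpa using hb0
    · rw [inv_mul_le_iff₀ h]
      calc _ ≤ bnd ω * |ω - y| := hsb ω
        _ ≤ bnd ω * ‖(y : ℂ) * I + ε - I * ω‖ := mul_le_mul_of_nonneg_left (hker ε ω) hb0
        _ = _ := mul_comm _ _
  have hmeas : ∀ ε : ℝ, AEStronglyMeasurable (fun ω : ℝ => ((y : ℂ) * I + ε - I * ω)⁻¹ * s ω) := by
    intro ε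
    refine AEStronglyMeasurable.mul ?_ hsi.aestronglyMeasurable
    exact (by fun_prop : Measurable fun ω : ℝ => ((y : ℂ) * I + ε - I * ω)⁻¹).aestronglyMeasurable
  set R : ℂ := ∫ ω : ℝ, ((y : ℂ) * I + (0 : ℝ) - I * ω)⁻¹ * s ω with hR
  have hlim1 : Tendsto (fun ε : ℝ => ∫ ω : ℝ, ((y : ℂ) * I + ε - I * ω)⁻¹ * s ω)
      (𝓝[>] 0) (𝓝 R) := by
    refine tendsto_integral_filter_of_dominated_convergence bnd
      (Eventually.of_forall hmeas) (Eventually.of_forall fun ε => Eventually.of_forall (hker2 ε))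
      hbi ?_
    have hne : ∀ᵐ ω : ℝ, ω ≠ y := by simp [ae_iff]
    filter_upwards [hne] with ω hω
    refine Tendsto.mono_left ?_ nhdsWithin_le_nhds
    have h0 : (y : ℂ) * I + (0 : ℝ) - I * ω ≠ 0 := by
      intro h
      have := congrArg Complex.im h
      simp at this
      exact hω (by linarith)
    have : ContinuousAt (fun ε : ℝ => ((y : ℂ) * I + ε - I * ω)⁻¹ * s ω) 0 :=
      ContinuousAt.mul (ContinuousAt.inv₀ (f := fun ε : ℝ => (y : ℂ) * I + ε - I * ω)
        (by fun_prop) h0) continuousAt_const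
    exact this.tendsto
  have hlim2 := (tendsto_kernel_interval y hρ).mul_const (f y)
  refine ⟨Real.pi * f y + R, ?_, ?_⟩
  · refine Tendsto.congr' ?_ (hlim2.add hlim1)
    filter_upwards [self_mem_nhdsWithin] with ε hε
    have hε' : (0 : ℝ) < ε := hε
    have hk0 : ∀ ω : ℝ, (y : ℂ) * I + ε - I * ω ≠ 0 := by
      intro ω h
      have := congrArg Complex.re h
      simp at this
      linarith
    have e1 : (∫ ω in (y - ρ)..(y + ρ), ((y : ℂ) * I + ε - I * ω)⁻¹) * f y
        = ∫ ω : ℝ, ((y : ℂ) * I + ε - I * ω)⁻¹ * S.indicator (fun _ => f y) ω := by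
      rw [intervalIntegral.integral_of_le (by linarith), ← integral_Icc_eq_integral_Ioc,
        ← integral_mul_const, ← integral_indicator hSm]
      congr 1
      funext ω
      by_cases hω : ω ∈ S
      · rw [indicator_of_mem hω, indicator_of_mem hω]
      · rw [indicator_of_notMem hω, indicator_of_notMem hω, mul_zero]
    have e2 : Integrable fun ω : ℝ => ((y : ℂ) * I + ε - I * ω)⁻¹ * S.indicator (fun _ => f y) ω := by
      have hc : Continuous fun ω : ℝ => ((y : ℂ) * I + ε - I * ω)⁻¹ * f y :=
        Continuous.mul (Continuous.inv₀ (f := fun ω : ℝ => (y : ℂ) * I + ε - I * ω)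
          (by fun_prop) hk0) continuous_const
      have h5 : (fun ω : ℝ => ((y : ℂ) * I + ε - I * ω)⁻¹ * S.indicator (fun _ => f y) ω)
          = S.indicator fun ω : ℝ => ((y : ℂ) * I + ε - I * ω)⁻¹ * f y := by
        funext ω
        by_cases hω : ω ∈ S
        · rw [indicator_of_mem hω, indicator_of_mem hω]
        · rw [indicator_of_notMem hω, indicator_of_notMem hω, mul_zero]
      rw [h5, integrable_indicator_iff hSm]
      exact hc.continuousOn.integrableOn_compact isCompact_Icc
    have e3 : Integrable fun ω : ℝ => ((y : ℂ) * I + ε - I * ω)⁻¹ * s ω :=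
      hbi.mono' (hmeas ε) (Eventually.of_forall (hker2 ε))
    rw [e1, ← integral_add e2 e3]
    congr 1
    funext ω
    simp only [hs]
    ring
  · refine (norm_add_le _ _).trans (add_le_add ?_ ?_)
    · rw [norm_mul, Complex.norm_real, Real.norm_eq_abs, abs_of_pos Real.pi_pos]
    · refine (norm_integral_le_of_norm_le hbi (Eventually.of_forall (hker2 0))).trans ?_
      simp only [hbnd]
      rw [integral_add ((integrable_indicator_iff hSm).2 (by simp [hS])) (hf.norm.const_mul _),
        integral_const_mul, integral_indicator hSm]
      simp [hS]
      rw [max_eq_left (by linarith)]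
      nlinarith

/-- Near a real point the products `ψ φ g` are Lipschitz, with constants controlled by `φ`. -/
lemma exists_lipschitz (ω₀ h : ℝ) (ψ : Exp) (β : ℕ) (n : ℕ+) (y : ℝ) :
    ∃ ρ : ℝ, 0 < ρ ∧ ∃ C : ℝ, 0 ≤ C ∧ ∀ (f : ExpStep β n) (ω : ℝ), |ω - y| ≤ ρ →
      ‖Exp.ev (ω : ℂ) ψ * Exp.ev (ω : ℂ) (Exp.incl β n f) * gauss ω₀ h (ω : ℂ)
        - Exp.ev (y : ℂ) ψ * Exp.ev (y : ℂ) (Exp.incl β n f) * gauss ω₀ h (y : ℂ)‖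
        ≤ C * ‖f‖ * |ω - y| := by
  obtain ⟨β', n', f', rfl⟩ := ψ.exists_incl
  have hn : (0 : ℝ) < 1 / (n : ℝ) := by
    have : (0 : ℝ) < n := by exact_mod_cast n.pos
    positivity
  have hn' : (0 : ℝ) < 1 / (n' : ℝ) := by
    have : (0 : ℝ) < n' := by exact_mod_cast n'.pos
    positivity
  set R : ℝ := min (1 / (n : ℝ)) (1 / (n' : ℝ)) with hR
  have hR0 : 0 < R := lt_min hn hn'
  obtain ⟨F', hF', hFf'⟩ := f'.2.1
  obtain ⟨G0, hG0⟩ := (isCompact_closedBall (y : ℂ) R).exists_bound_of_continuousOn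
    (gauss_continuous ω₀ h).continuousOn
  have hG00 : 0 ≤ G0 := (norm_nonneg _).trans (hG0 y (Metric.mem_closedBall_self hR0.le))
  set M : ℝ := ‖f'‖ * Real.exp (β' * (|y| + R)) * Real.exp (β * (|y| + R)) * G0 with hM
  have hM0 : 0 ≤ M := by positivity
  refine ⟨R / 2, by positivity, 2 * M / R, by positivity, fun f ω hω => ?_⟩
  obtain ⟨F, hF, hFf⟩ := f.2.1
  have him : ∀ z ∈ Metric.ball (y : ℂ) R, -R < z.im := by
    intro z hz
    rw [Metric.mem_ball, dist_eq_norm] at hz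
    have h1 := (Complex.abs_im_le_norm (z - y)).trans_lt hz
    simp at h1
    exact (abs_lt.1 h1).1
  have hno : ∀ z ∈ Metric.ball (y : ℂ) R, ‖z‖ ≤ |y| + R := by
    intro z hz
    rw [Metric.mem_ball, dist_eq_norm] at hz
    have h1 := norm_sub_norm_le z (y : ℂ)
    rw [Complex.norm_real, Real.norm_eq_abs] at h1
    linarith
  set H : ℂ → ℂ := fun z => F' z * F z * gauss ω₀ h z with hH
  have hHd : DifferentiableOn ℂ H (Metric.ball (y : ℂ) R) := by
    refine ((hF'.differentiableOn.mono ?_).mul (hF.differentiableOn.mono ?_)).mul ?_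
    · intro z hz
      have h1 := him z hz
      have h2 : R ≤ 1 / (n' : ℝ) := min_le_right _ _
      exact lt_of_le_of_lt (neg_le_neg h2) h1
    · intro z hz
      have h1 := him z hz
      have h2 : R ≤ 1 / (n : ℝ) := min_le_left _ _
      exact lt_of_le_of_lt (neg_le_neg h2) h1
    · have : Differentiable ℂ (gauss ω₀ h) := by
        unfold gauss
        fun_prop
      exact this.differentiableOn
  have hHb : ∀ z ∈ Metric.ball (y : ℂ) R, ‖H z‖ ≤ M * ‖f‖ := by
    intro z hz
    have h1 := him z hz
    have h2 : -(1 / (n : ℝ)) ≤ z.im := by linarith [min_le_left (1 / (n : ℝ)) (1 / (n' : ℝ))]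
    have h3 : -(1 / (n' : ℝ)) ≤ z.im := by linarith [min_le_right (1 / (n : ℝ)) (1 / (n' : ℝ))]
    have h4 : ‖F z‖ ≤ ‖f‖ * Real.exp (β * (|y| + R)) := by
      rw [hFf ⟨z, h2⟩]
      refine (f.norm_apply_le ⟨z, h2⟩).trans ?_
      have := hno z hz
      dsimp only
      gcongr
    have h5 : ‖F' z‖ ≤ ‖f'‖ * Real.exp (β' * (|y| + R)) := by
      rw [hFf' ⟨z, h3⟩]
      refine (f'.norm_apply_le ⟨z, h3⟩).trans ?_
      have := hno z hz
      dsimp only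
      gcongr
    have h6 := hG0 z (Metric.ball_subset_closedBall hz)
    simp only [hH]
    rw [norm_mul, norm_mul]
    calc _ ≤ (‖f'‖ * Real.exp (β' * (|y| + R))) * (‖f‖ * Real.exp (β * (|y| + R))) * G0 := by
          gcongr
      _ = M * ‖f‖ := by rw [hM]; ring
  have hyb : (y : ℂ) ∈ Metric.ball (y : ℂ) R := Metric.mem_ball_self hR0
  have hωb : (ω : ℂ) ∈ Metric.ball (y : ℂ) R := by
    rw [Metric.mem_ball, dist_eq_norm, ← Complex.ofReal_sub, Complex.norm_real, Real.norm_eq_abs]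
    linarith
  have hmaps : MapsTo H (Metric.ball (y : ℂ) R) (Metric.closedBall (H y) (2 * M * ‖f‖)) := by
    intro z hz
    rw [Metric.mem_closedBall, dist_eq_norm]
    have := norm_sub_le (H z) (H y)
    linarith [hHb z hz, hHb y hyb]
  have key := Complex.dist_le_div_mul_dist_of_mapsTo_ball hHd hmaps hωb
  rw [dist_eq_norm, dist_eq_norm, ← Complex.ofReal_sub, Complex.norm_real, Real.norm_eq_abs] at key
  have hval : ∀ x : ℝ, Exp.ev (x : ℂ) (Exp.incl β' n' f') * Exp.ev (x : ℂ) (Exp.incl β n f)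
      * gauss ω₀ h (x : ℂ) = H x := by
    intro x
    rw [Exp.ev_incl f' (by simp), Exp.ev_incl f (by simp), ← hFf', ← hFf]
    rfl
  rw [hval, hval]
  refine key.trans (le_of_eq ?_)
  ring

/-- The Cauchy integral `∫ ψ(ω) φ(ω) g(ω) / (z - iω) dω`, which for `Re z ≠ 0` equals the pairing of
`(z - iM)⁻¹ ψ` with `φ`, where `M` is the multiplication by `ω`. -/
noncomputable def cauchyForm (ω₀ h : ℝ) (z : ℂ) (ψ φ : Exp) : ℂ :=
  ∫ ω : ℝ, (z - I * ω)⁻¹ * (Exp.ev (ω : ℂ) ψ * Exp.ev (ω : ℂ) φ * gauss ω₀ h (ω : ℂ))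

/-- The pairing `⟨A(z) kap ψ | φ⟩`, i.e. the continuation of the Cauchy integral from `Re z > 0` to the
whole plane. -/
noncomputable def resolventForm (ω₀ h : ℝ) (z : ℂ) (ψ φ : Exp) : ℂ :=
  if 0 < z.re then
    cauchyForm ω₀ h z ψ φ
  else if z.re = 0 then
    limUnder (𝓝[>] (0 : ℝ)) fun ε : ℝ => cauchyForm ω₀ h (z + ε) ψ φ
  else
    cauchyForm ω₀ h z ψ φ
      + 2 * Real.pi * (Exp.ev (z / I) ψ * Exp.ev (z / I) φ * gauss ω₀ h (z / I))

lemma cauchyForm_comm (ω₀ h : ℝ) (z : ℂ) (ψ φ : Exp) :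
    cauchyForm ω₀ h z ψ φ = cauchyForm ω₀ h z φ ψ := by
  unfold cauchyForm
  congr 1; funext ω; ring

lemma resolventForm_comm (ω₀ h : ℝ) (z : ℂ) (ψ φ : Exp) :
    resolventForm ω₀ h z ψ φ = resolventForm ω₀ h z φ ψ := by
  unfold resolventForm
  simp only [cauchyForm_comm ω₀ h _ ψ φ, mul_comm (Exp.ev (z / I) ψ)]

lemma norm_kernel_le {z : ℂ} (hz : z.re ≠ 0) (ω : ℝ) : ‖(z - I * ω)⁻¹‖ ≤ |z.re|⁻¹ := by
  rw [norm_inv]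
  refine inv_anti₀ (abs_pos.2 hz) ?_
  simpa using Complex.abs_re_le_norm (z - I * ω)

lemma integrable_cauchy (ω₀ : ℝ) {h : ℝ} (hh : 0 < h) {z : ℂ} (hz : z.re ≠ 0) (ψ φ : Exp) :
    Integrable fun ω : ℝ =>
      (z - I * ω)⁻¹ * (Exp.ev (ω : ℂ) ψ * Exp.ev (ω : ℂ) φ * gauss ω₀ h (ω : ℂ)) := by
  refine (integrable_prod ω₀ hh ψ φ).bdd_mul (c := |z.re|⁻¹) ?_
    (Eventually.of_forall (norm_kernel_le hz))
  exact (by fun_prop : Measurable fun ω : ℝ => (z - I * ω)⁻¹).aestronglyMeasurable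

lemma cauchyForm_add (ω₀ : ℝ) {h : ℝ} (hh : 0 < h) {z : ℂ} (hz : z.re ≠ 0) (ψ φ φ' : Exp) :
    cauchyForm ω₀ h z ψ (φ + φ') = cauchyForm ω₀ h z ψ φ + cauchyForm ω₀ h z ψ φ' := by
  unfold cauchyForm
  rw [← integral_add (integrable_cauchy ω₀ hh hz ψ φ) (integrable_cauchy ω₀ hh hz ψ φ')]
  congr 1; funext ω; rw [map_add]; ring

lemma cauchyForm_smul (ω₀ h : ℝ) (z c : ℂ) (ψ φ : Exp) :
    cauchyForm ω₀ h z ψ (c • φ) = c * cauchyForm ω₀ h z ψ φ := by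
  unfold cauchyForm
  rw [← integral_const_mul]
  congr 1; funext ω; rw [map_smul, smul_eq_mul]; ring

lemma cauchyForm_bound (ω₀ : ℝ) {h : ℝ} (hh : 0 < h) {z : ℂ} (hz : z.re ≠ 0) (ψ : Exp)
    (β : ℕ) (n : ℕ+) :
    ∃ C : ℝ, ∀ f : ExpStep β n, ‖cauchyForm ω₀ h z ψ (Exp.incl β n f)‖ ≤ C * ‖f‖ := by
  obtain ⟨C, hC⟩ := integral_norm_prod_le ω₀ hh ψ β n
  refine ⟨|z.re|⁻¹ * C, fun f => ?_⟩
  have hp := integrable_prod ω₀ hh ψ (Exp.incl β n f)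
  have h1 : ‖cauchyForm ω₀ h z ψ (Exp.incl β n f)‖ ≤ ∫ ω : ℝ, |z.re|⁻¹ *
      ‖Exp.ev (ω : ℂ) ψ * Exp.ev (ω : ℂ) (Exp.incl β n f) * gauss ω₀ h (ω : ℂ)‖ := by
    refine norm_integral_le_of_norm_le (hp.norm.const_mul _) (Eventually.of_forall fun ω => ?_)
    rw [norm_mul]
    exact mul_le_mul_of_nonneg_right (norm_kernel_le hz ω) (norm_nonneg _)
  rw [integral_const_mul] at h1
  refine h1.trans ?_
  rw [mul_assoc]
  exact mul_le_mul_of_nonneg_left (hC f) (by positivity)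

lemma boundary_aux (ω₀ : ℝ) {h : ℝ} (hh : 0 < h) {z : ℂ} (hz : z.re = 0) (ψ : Exp)
    (β : ℕ) (n : ℕ+) :
    ∃ C : ℝ, ∀ f : ExpStep β n, ∃ L : ℂ,
      Tendsto (fun ε : ℝ => cauchyForm ω₀ h (z + ε) ψ (Exp.incl β n f)) (𝓝[>] (0 : ℝ)) (𝓝 L) ∧
        ‖L‖ ≤ C * ‖f‖ := by
  obtain ⟨ρ, hρ, C, hC0, hC⟩ := exists_lipschitz ω₀ h ψ β n z.im
  obtain ⟨C', hC'⟩ := integral_norm_prod_le ω₀ hh ψ β n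
  have hzeq : z = (z.im : ℂ) * I := by
    apply Complex.ext <;> simp [hz]
  refine ⟨Real.pi * (‖Exp.ev (z.im : ℂ) ψ‖ * Real.exp (β * |z.im|) * ‖gauss ω₀ h (z.im : ℂ)‖)
    + (2 * ρ * C + (1 / ρ) * C'), fun f => ?_⟩
  obtain ⟨L, hL, hLb⟩ := exists_boundary_limit (integrable_prod ω₀ hh ψ (Exp.incl β n f)) z.im
    hρ (C := C * ‖f‖) (by positivity) (fun ω hω => hC f ω hω)
  refine ⟨L, ?_, hLb.trans ?_⟩
  · rw [← hzeq] at hL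
    exact hL
  · have h1 := Exp.norm_ev_incl_le f (z := (z.im : ℂ)) (by simp)
    rw [Complex.norm_real, Real.norm_eq_abs] at h1
    have h2 := hC' f
    have h3 : ‖Exp.ev (z.im : ℂ) ψ * Exp.ev (z.im : ℂ) (Exp.incl β n f) * gauss ω₀ h (z.im : ℂ)‖
        ≤ ‖Exp.ev (z.im : ℂ) ψ‖ * (‖f‖ * Real.exp (β * |z.im|)) * ‖gauss ω₀ h (z.im : ℂ)‖ := by
      rw [norm_mul, norm_mul]
      gcongr
    calc _ ≤ Real.pi * (‖Exp.ev (z.im : ℂ) ψ‖ * (‖f‖ * Real.exp (β * |z.im|))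
            * ‖gauss ω₀ h (z.im : ℂ)‖) + (2 * ρ * (C * ‖f‖) + (1 / ρ) * (C' * ‖f‖)) := by
          gcongr
      _ = _ := by ring

/-- The limit in the definition of `resolventForm` on the imaginary axis exists. -/
lemma tendsto_resolventForm (ω₀ : ℝ) {h : ℝ} (hh : 0 < h) {z : ℂ} (hz : z.re = 0) (ψ φ : Exp) :
    Tendsto (fun ε : ℝ => cauchyForm ω₀ h (z + ε) ψ φ) (𝓝[>] (0 : ℝ))
      (𝓝 (resolventForm ω₀ h z ψ φ)) := by
  obtain ⟨β, n, f, rfl⟩ := φ.exists_incl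
  obtain ⟨C, hC⟩ := boundary_aux ω₀ hh hz ψ β n
  obtain ⟨L, hL, -⟩ := hC f
  have : resolventForm ω₀ h z ψ (Exp.incl β n f) = L := by
    rw [resolventForm, if_neg (by simp [hz]), if_pos hz]
    exact hL.limUnder_eq
  rw [this]
  exact hL

lemma resolventForm_add (ω₀ : ℝ) {h : ℝ} (hh : 0 < h) (z : ℂ) (ψ φ φ' : Exp) :
    resolventForm ω₀ h z ψ (φ + φ')
      = resolventForm ω₀ h z ψ φ + resolventForm ω₀ h z ψ φ' := by
  by_cases hz : z.re = 0
  · refine tendsto_nhds_unique (tendsto_resolventForm ω₀ hh hz ψ (φ + φ')) (Tendsto.congr' ?_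
      ((tendsto_resolventForm ω₀ hh hz ψ φ).add (tendsto_resolventForm ω₀ hh hz ψ φ')))
    filter_upwards [self_mem_nhdsWithin] with ε hε
    refine (cauchyForm_add ω₀ hh ?_ ψ φ φ').symm
    have hε' : (0 : ℝ) < ε := hε
    simp [hz, hε'.ne']
  · unfold resolventForm
    simp only [if_neg hz, cauchyForm_add ω₀ hh hz, map_add]
    split_ifs
    · rfl
    · ring

lemma resolventForm_smul (ω₀ : ℝ) {h : ℝ} (hh : 0 < h) (z c : ℂ) (ψ φ : Exp) :
    resolventForm ω₀ h z ψ (c • φ) = c * resolventForm ω₀ h z ψ φ := by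
  by_cases hz : z.re = 0
  · refine tendsto_nhds_unique (tendsto_resolventForm ω₀ hh hz ψ (c • φ)) (Tendsto.congr' ?_
      ((tendsto_resolventForm ω₀ hh hz ψ φ).const_mul c))
    exact Eventually.of_forall fun ε => (cauchyForm_smul ω₀ h _ c ψ φ).symm
  · unfold resolventForm
    simp only [if_neg hz, cauchyForm_smul, map_smul, smul_eq_mul]
    split_ifs
    · rfl
    · ring

lemma resolventForm_bound (ω₀ : ℝ) {h : ℝ} (hh : 0 < h) (z : ℂ) (ψ : Exp) (β : ℕ) (n : ℕ+) :
    ∃ C : ℝ, ∀ f : ExpStep β n, ‖resolventForm ω₀ h z ψ (Exp.incl β n f)‖ ≤ C * ‖f‖ := by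
  by_cases hz : z.re = 0
  · obtain ⟨C, hC⟩ := boundary_aux ω₀ hh hz ψ β n
    refine ⟨C, fun f => ?_⟩
    obtain ⟨L, hL, hLb⟩ := hC f
    rwa [tendsto_nhds_unique (tendsto_resolventForm ω₀ hh hz ψ (Exp.incl β n f)) hL]
  · obtain ⟨C, hC⟩ := cauchyForm_bound ω₀ hh hz ψ β n
    by_cases hz' : 0 < z.re
    · exact ⟨C, fun f => by rw [resolventForm, if_pos hz']; exact hC f⟩
    · refine ⟨C + 2 * Real.pi * (‖Exp.ev (z / I) ψ‖ * Real.exp (β * ‖z / I‖)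
        * ‖gauss ω₀ h (z / I)‖), fun f => ?_⟩
      rw [resolventForm, if_neg hz', if_neg hz]
      refine (norm_add_le _ _).trans ?_
      have him : 0 ≤ (z / I).im := by
        rw [Complex.div_I]
        simpa using le_of_not_gt hz'
      have h1 := Exp.norm_ev_incl_le f him
      have h2 : ‖2 * (Real.pi : ℂ) * (Exp.ev (z / I) ψ * Exp.ev (z / I) (Exp.incl β n f)
          * gauss ω₀ h (z / I))‖ ≤ 2 * Real.pi * (‖Exp.ev (z / I) ψ‖ *
            (‖f‖ * Real.exp (β * ‖z / I‖)) * ‖gauss ω₀ h (z / I)‖) := by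
        simp only [norm_mul, Complex.norm_real, Real.norm_eq_abs, abs_of_pos Real.pi_pos,
          Complex.norm_two]
        gcongr
      calc _ ≤ C * ‖f‖ + 2 * Real.pi * (‖Exp.ev (z / I) ψ‖ *
            (‖f‖ * Real.exp (β * ‖z / I‖)) * ‖gauss ω₀ h (z / I)‖) := add_le_add (hC f) h2
        _ = _ := by ring

/-- The operator `A(z) kap : Exp → Exp'`. -/
noncomputable def resolventOp (ω₀ : ℝ) {h : ℝ} (hh : 0 < h) (z : ℂ) :
    Exp →ₗ[ℂ] WeakDual ℂ Exp where
  toFun ψ := Exp.mkDual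
    { toFun := resolventForm ω₀ h z ψ
      map_add' := resolventForm_add ω₀ hh z ψ
      map_smul' := fun c φ => resolventForm_smul ω₀ hh z c ψ φ }
    (resolventForm_bound ω₀ hh z ψ)
  map_add' ψ ψ' := by
    refine DFunLike.ext _ _ fun φ => ?_
    change resolventForm ω₀ h z (ψ + ψ') φ
      = resolventForm ω₀ h z ψ φ + resolventForm ω₀ h z ψ' φ
    rw [resolventForm_comm, resolventForm_add ω₀ hh, resolventForm_comm ω₀ h z φ,
      resolventForm_comm ω₀ h z φ]
  map_smul' c ψ := by
    refine DFunLike.ext _ _ fun φ => ?_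
    change resolventForm ω₀ h z (c • ψ) φ = c * resolventForm ω₀ h z ψ φ
    rw [resolventForm_comm, resolventForm_smul ω₀ hh, resolventForm_comm ω₀ h z φ]

/-! ## The spectra of the delayed Kuramoto linearization

These are the generalized spectra of `u'(t) = i M u(t) + (k/2) P u(t - τ)` on the triple
`Exp ⊂ L²(ℝ, g dω) ⊂ Exp'`, where `g` is the Gaussian density with parameters `ω₀` and `h`. -/

/-- The generalized spectrum. -/
noncomputable def spectrumKM (k ω₀ τ : ℝ) {h : ℝ} (hh : 0 < h) : Set ℂ :=
  genSpectrum (kappa ω₀ hh) (resolventOp ω₀ hh) (dualOp (couplingOp k ω₀ hh)) τ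

/-- The set of generalized eigenvalues. -/
noncomputable def pointSpectrumKM (k ω₀ τ : ℝ) {h : ℝ} (hh : 0 < h) : Set ℂ :=
  genPointSpectrum (kappa ω₀ hh) (resolventOp ω₀ hh) (dualOp (couplingOp k ω₀ hh)) τ

/-- The generalized continuous spectrum. -/
noncomputable def continuousSpectrumKM (k ω₀ τ : ℝ) {h : ℝ} (hh : 0 < h) : Set ℂ :=
  genContinuousSpectrum (kappa ω₀ hh) (resolventOp ω₀ hh) (dualOp (couplingOp k ω₀ hh)) τ

/-- The generalized residual spectrum. -/
noncomputable def residualSpectrumKM (k ω₀ τ : ℝ) {h : ℝ} (hh : 0 < h) : Set ℂ :=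
  genResidualSpectrum (kappa ω₀ hh) (resolventOp ω₀ hh) (dualOp (couplingOp k ω₀ hh)) τ

/-- The critical coupling strength `k_c(τ) = (2/τ) arccos(cos(ω₀τ)) - π/τ`. -/
noncomputable def criticalCoupling (ω₀ τ : ℝ) : ℝ :=
  2 / τ * Real.arccos (Real.cos (ω₀ * τ)) - Real.pi / τ

end DelayedKuramoto

/-! The dual perturbation has rank one: it sends `u` to (k/2)⟨u|𝟙⟩ κ𝟙. Hence every spectral question
at z is decided by the scalar f(z) = 1 − (k/2)e^{−zτ}⟨A(z)κ𝟙|𝟙⟩.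

Part (a). Since κ is injective, f(z) = 0 characterizes both the generalized eigenvalues and the
failure of injectivity (`isGenEigenvalue_iff`, `injective_charOp_iff`). Where f(z) ≠ 0 the inverse
is an explicit rank-one correction defined on all of X, so no residual spectrum can occur. Such a z
lies in the resolvent set because z ↦ ⟨A(z)κψ|φ⟩ is continuous on all of ℂ: on a compact
neighborhood where f ≠ 0 the explicit resolvent is then pointwise bounded. The two analytic inputs
are `injective_kappa`, by Fourier inversion, and `continuous_resolventForm`. For the latter the
contour is moved up to Im w = δ: the three cases in the definition of A(z) become one Cauchy
integral, valid for Re z > −δ, and the term 2πψφg is the residue picked up on the way.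

Part (b). With h = s² and λ = z − iω₀, scaling turns the eigenvalue equation on Re z ≥ 0 into
v·s·D(sλ) = 1. Here v = (k/2)e^{−zτ}, and D belongs to the fixed density e^{−ω²}/√π. On the closed
right half-plane D has no zeros (`dispersion_ne_zero`), and ζD(ζ) → 1 at infinity
(`norm_mul_dispersion_sub_one_le`). If sλ stays in a fixed disc, |D| is bounded below and the
equation fails for large s. Otherwise λ = vE with E close to 1, a perturbation of the scalar delay
equation λ = v to which the problem degenerates as g concentrates at ω₀. Then |λ| is at most
slightly more than |k|/2, so the phase of e^{−zτ} differs from −ω₀τ by at most slightly more than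
|k|τ/2. The condition on k_c says exactly that k·cos stays negative on this range
(`exists_mul_cos_le`). This forces Re λ < 0, a contradiction. -/

namespace DelayedKuramoto

/-! ## Shifting contours of integration -/

/-- If `G` is holomorphic in a strip up to countably many points where it is continuous, and
decays at infinity, its integrals along the two boundary lines agree. -/
lemma integral_horizontal_line_eq {G : ℂ → ℂ} {a b : ℝ} (hab : a ≤ b) {s : Set ℂ}
    (hs : s.Countable) (hc : ContinuousOn G {z | z.im ∈ Icc a b})
    (hd : ∀ z : ℂ, z.im ∈ Ioo a b → z ∉ s → DifferentiableAt ℂ G z) {B : ℝ → ℝ}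
    (hB : Tendsto B (cocompact ℝ) (𝓝 0))
    (hGB : ∀ᶠ x : ℝ in cocompact ℝ, ∀ y ∈ Icc a b, ‖G (x + y * I)‖ ≤ B x)
    (ha : Integrable fun x : ℝ => G (x + a * I)) (hb : Integrable fun x : ℝ => G (x + b * I)) :
    ∫ x : ℝ, G (x + a * I) = ∫ x : ℝ, G (x + b * I) := by
  -- Cauchy's theorem on the rectangle [−T, T] × [a, b]; the vertical sides have fixed length b − a
  -- and are controlled by B(±T).
  have hrect : ∀ T : ℝ, 0 ≤ T →
      (∫ x : ℝ in (-T)..T, G (x + a * I)) - (∫ x : ℝ in (-T)..T, G (x + b * I)) =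
      I • (∫ y : ℝ in a..b, G ((-T : ℝ) + y * I)) - I • (∫ y : ℝ in a..b, G (T + y * I)) := by
    intro T hT
    have key := Complex.integral_boundary_rect_eq_zero_of_differentiable_on_off_countable G
      (⟨-T, a⟩ : ℂ) (⟨T, b⟩ : ℂ) s hs
      (hc.mono fun z hz => by
        have := (Complex.mem_reProdIm.1 hz).2
        simpa [uIcc_of_le hab] using this)
      (fun z hz => hd z (by
        have := (Complex.mem_reProdIm.1 hz.1).2
        simpa [min_eq_left hab, max_eq_right hab] using this) hz.2)
    simp only at key
    linear_combination key
  have hvert : ∀ l : Filter ℝ, l ≤ cocompact ℝ →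
      Tendsto (fun T : ℝ => I • (∫ y : ℝ in a..b, G (T + y * I))) l (𝓝 0) := by
    intro l hl
    have h0 : Tendsto (fun T : ℝ => B T * |b - a|) l (𝓝 0) := by
      simpa using (hB.mono_left hl).mul_const |b - a|
    refine squeeze_zero_norm' ?_ h0
    filter_upwards [hl hGB] with T hT
    rw [norm_smul, norm_I, one_mul]
    refine intervalIntegral.norm_integral_le_of_norm_le_const fun y hy => hT y ?_
    rw [uIoc_of_le hab] at hy
    exact Ioc_subset_Icc_self hy
  have h1 : Tendsto (fun T : ℝ => (∫ x : ℝ in (-T)..T, G (x + a * I))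
      - (∫ x : ℝ in (-T)..T, G (x + b * I))) atTop
      (𝓝 ((∫ x : ℝ, G (x + a * I)) - ∫ x : ℝ, G (x + b * I))) :=
    (intervalIntegral_tendsto_integral ha tendsto_neg_atTop_atBot tendsto_id).sub
      (intervalIntegral_tendsto_integral hb tendsto_neg_atTop_atBot tendsto_id)
  have h2 : Tendsto (fun T : ℝ => I • (∫ y : ℝ in a..b, G ((-T : ℝ) + y * I))
      - I • (∫ y : ℝ in a..b, G (T + y * I))) atTop (𝓝 (0 - 0)) :=
    ((hvert atBot (by rw [cocompact_eq_atBot_atTop]; exact le_sup_left)).comp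
      tendsto_neg_atTop_atBot).sub
      (hvert atTop (by rw [cocompact_eq_atBot_atTop]; exact le_sup_right))
  rw [sub_zero] at h2
  have h3 : Tendsto (fun T : ℝ => (∫ x : ℝ in (-T)..T, G (x + a * I))
      - (∫ x : ℝ in (-T)..T, G (x + b * I))) atTop (𝓝 0) :=
    h2.congr' (by filter_upwards [eventually_ge_atTop 0] with T hT using (hrect T hT).symm)
  exact sub_eq_zero.1 (tendsto_nhds_unique h1 h3)

/-! ### Model integrals and decay along horizontal lines -/

lemma integrable_inv_sq_add_sq {c : ℝ} (hc : 0 < c) (r : ℝ) :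
    Integrable fun x : ℝ => ((x - r) ^ 2 + c ^ 2)⁻¹ := by
  have h1 := ((integrable_inv_one_add_sq.comp_mul_left' (inv_ne_zero hc.ne')).const_mul
    ((c ^ 2)⁻¹)).comp_sub_right r
  refine h1.congr (Eventually.of_forall fun x => ?_)
  simp only
  rw [← mul_inv]
  congr 1
  field_simp
  ring

lemma integral_inv_sq_add_sq {c : ℝ} (hc : 0 < c) (r : ℝ) :
    ∫ x : ℝ, ((x - r) ^ 2 + c ^ 2)⁻¹ = Real.pi / c := by
  rw [integral_sub_right_eq_self (fun x : ℝ => (x ^ 2 + c ^ 2)⁻¹) r]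
  have h1 : ∀ x : ℝ, (x ^ 2 + c ^ 2)⁻¹ = (c ^ 2)⁻¹ * (1 + (c⁻¹ * x) ^ 2)⁻¹ := by
    intro x
    rw [← mul_inv]
    congr 1
    field_simp
    ring
  simp_rw [h1]
  rw [integral_const_mul, Measure.integral_comp_mul_left (fun x : ℝ => (1 + x ^ 2)⁻¹),
    integral_univ_inv_one_add_sq, inv_inv, abs_of_pos hc, smul_eq_mul]
  field_simp

lemma tendsto_const_div_abs_sub (M r : ℝ) :
    Tendsto (fun x : ℝ => M / |x - r|) (cocompact ℝ) (𝓝 0) := by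
  have h1 : Tendsto (fun x : ℝ => |x - r|) (cocompact ℝ) atTop := by
    have h2 : Tendsto (fun x : ℝ => ‖x‖ - |r|) (cocompact ℝ) atTop :=
      tendsto_atTop_add_const_right _ _ tendsto_norm_cocompact_atTop
    refine tendsto_atTop_mono (fun x => ?_) h2
    exact abs_sub_abs_le_abs_sub x r
  exact h1.const_div_atTop M

lemma eventually_one_le_abs_sub (r : ℝ) : ∀ᶠ x : ℝ in cocompact ℝ, 1 ≤ |x - r| := by
  have h := (tendsto_const_div_abs_sub 1 r).eventually (gt_mem_nhds one_pos)
  have h0 : ∀ᶠ x : ℝ in cocompact ℝ, x ≠ r := by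
    have : {r}ᶜ ∈ cocompact ℝ := isCompact_singleton.compl_mem_cocompact
    filter_upwards [this] with x hx using hx
  filter_upwards [h, h0] with x hx hx0
  have : 0 < |x - r| := abs_pos.2 (sub_ne_zero.2 hx0)
  rw [div_lt_one this] at hx
  exact hx.le

/-- The integral of `1 / ((w - p) (w - p̄))` over a line above both poles vanishes. -/
lemma integral_inv_mul_conj_eq_zero {p : ℂ} (hp : 0 < p.im) {δ : ℝ} (hδ : p.im < δ) :
    ∫ x : ℝ, (((x : ℂ) + δ * I - p) * ((x : ℂ) + δ * I - starRingEnd ℂ p))⁻¹ = 0 := by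
  set G : ℂ → ℂ := fun w => ((w - p) * (w - starRingEnd ℂ p))⁻¹ with hG
  have hne : ∀ w : ℂ, p.im < w.im → (w - p) * (w - starRingEnd ℂ p) ≠ 0 := by
    intro w hw
    refine mul_ne_zero ?_ ?_ <;> intro h <;> have := congrArg Complex.im h <;> simp at this <;>
      linarith
  have hdiff : ∀ w : ℂ, p.im < w.im → DifferentiableAt ℂ G w := fun w hw =>
    DifferentiableAt.inv (by fun_prop) (hne w hw)
  have hnorm : ∀ x y : ℝ, p.im < y →
      ‖G (x + y * I)‖ ≤ ((x - p.re) ^ 2 + (y - p.im) ^ 2)⁻¹ := by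
    intro x y hy
    have e1 : ‖(x : ℂ) + y * I - p‖ ^ 2 = (x - p.re) ^ 2 + (y - p.im) ^ 2 := by
      rw [Complex.sq_norm, Complex.normSq_apply]; simp; ring
    have e2 : ‖(x : ℂ) + y * I - starRingEnd ℂ p‖ ^ 2 = (x - p.re) ^ 2 + (y + p.im) ^ 2 := by
      rw [Complex.sq_norm, Complex.normSq_apply]; simp; ring
    have h3 : ‖(x : ℂ) + y * I - p‖ ≤ ‖(x : ℂ) + y * I - starRingEnd ℂ p‖ := by
      refine (sq_le_sq₀ (norm_nonneg _) (norm_nonneg _)).1 ?_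
      rw [e1, e2]; nlinarith
    simp only [hG]
    rw [norm_inv, norm_mul]
    have h4 : 0 < (x - p.re) ^ 2 + (y - p.im) ^ 2 := by
      have := sq_pos_of_pos (sub_pos.2 hy); positivity
    refine inv_anti₀ h4 ?_
    rw [← e1, sq]
    exact mul_le_mul_of_nonneg_left h3 (norm_nonneg _)
  have hint : ∀ y : ℝ, p.im < y → Integrable fun x : ℝ => G (x + y * I) := by
    intro y hy
    refine (integrable_inv_sq_add_sq (sub_pos.2 hy) p.re).mono' ?_
      (Eventually.of_forall fun x => hnorm x y hy)
    refine Continuous.aestronglyMeasurable (continuous_iff_continuousAt.2 fun x => ?_)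
    exact ContinuousAt.comp (f := fun x : ℝ => (x : ℂ) + y * I)
      (hdiff _ (by simpa using hy)).continuousAt (by fun_prop)
  have hshift : ∀ H : ℝ, δ ≤ H → ∫ x : ℝ, G (x + δ * I) = ∫ x : ℝ, G (x + H * I) := by
    intro H hH
    refine integral_horizontal_line_eq hH countable_empty
      (fun w hw => (hdiff w (hδ.trans_le hw.1)).continuousAt.continuousWithinAt)
      (fun w hw _ => hdiff w (hδ.trans hw.1)) (tendsto_const_div_abs_sub 1 p.re) ?_
      (hint δ hδ) (hint H (hδ.trans_le hH))
    filter_upwards [eventually_one_le_abs_sub p.re] with x hx y hy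
    refine (hnorm x y (hδ.trans_le hy.1)).trans ?_
    rw [one_div]
    refine inv_anti₀ (by linarith) ?_
    have : |x - p.re| ^ 2 = (x - p.re) ^ 2 := sq_abs _
    nlinarith [sq_nonneg (y - p.im)]
  -- No pole lies above the line, so it may be raised to any height H, where the quadratic decay of
  -- the integrand makes the integral small.
  have hbound : ∀ᶠ H : ℝ in atTop, ‖∫ x : ℝ, G (x + δ * I)‖ ≤ Real.pi / (H - p.im) := by
    filter_upwards [eventually_ge_atTop δ] with H hH
    rw [hshift H hH, ← integral_inv_sq_add_sq (sub_pos.2 (hδ.trans_le hH)) p.re]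
    exact norm_integral_le_of_norm_le (integrable_inv_sq_add_sq (sub_pos.2 (hδ.trans_le hH)) p.re)
      (Eventually.of_forall fun x => hnorm x H (hδ.trans_le hH))
  have hlim : Tendsto (fun H : ℝ => Real.pi / (H - p.im)) atTop (𝓝 0) :=
    (tendsto_atTop_add_const_right _ _ tendsto_id).const_div_atTop _
  exact norm_le_zero_iff.1 (ge_of_tendsto hlim hbound)

/-- `F` is continuous in the closed strip `0 ≤ Im w ≤ δ`, holomorphic inside, and decays
exponentially. -/
structure DecaysOnStrip (F : ℂ → ℂ) (δ K : ℝ) : Prop where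
  continuousOn : ContinuousOn F {w | w.im ∈ Icc 0 δ}
  differentiableAt : ∀ w : ℂ, w.im ∈ Ioo 0 δ → DifferentiableAt ℂ F w
  bound : ∀ x : ℝ, ∀ y ∈ Icc 0 δ, ‖F (x + y * I)‖ ≤ K * Real.exp (-|x|)

lemma integrable_exp_neg_abs : Integrable fun x : ℝ => Real.exp (-|x|) := by
  have h1 := integrable_inv_one_add_sq.const_mul 2
  refine h1.mono' (by fun_prop) (Eventually.of_forall fun x => ?_)
  rw [Real.norm_eq_abs, abs_of_pos (Real.exp_pos _), Real.exp_neg, ← div_eq_mul_inv]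
  have h2 := Real.quadratic_le_exp_of_nonneg (abs_nonneg x)
  rw [sq_abs] at h2
  rw [inv_eq_one_div, div_le_div_iff₀ (Real.exp_pos _) (by positivity)]
  nlinarith [abs_nonneg x]

namespace DecaysOnStrip

variable {F : ℂ → ℂ} {δ K : ℝ}

lemma bound_nonneg (hF : DecaysOnStrip F δ K) (hδ : 0 ≤ δ) : 0 ≤ K := by
  have := (norm_nonneg _).trans (hF.bound 0 0 ⟨le_rfl, hδ⟩)
  simpa using this

lemma norm_le (hF : DecaysOnStrip F δ K) (hδ : 0 ≤ δ) {w : ℂ} (hw : w.im ∈ Icc 0 δ) :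
    ‖F w‖ ≤ K := by
  have h := hF.bound w.re w.im hw
  rw [Complex.re_add_im] at h
  refine h.trans (mul_le_of_le_one_right (hF.bound_nonneg hδ) ?_)
  simp

lemma continuous_line (hF : DecaysOnStrip F δ K) {y : ℝ} (hy : y ∈ Icc 0 δ) :
    Continuous fun x : ℝ => F (x + y * I) :=
  hF.continuousOn.comp_continuous (by fun_prop) fun x => by simpa using hy

lemma integrable_line_div (hF : DecaysOnStrip F δ K) {y : ℝ} (hy : y ∈ Icc 0 δ) {p : ℂ}
    (hp : p.im ≠ y) : Integrable fun x : ℝ => F (x + y * I) / (x + y * I - p) := by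
  have hd : 0 < |y - p.im| := abs_pos.2 (sub_ne_zero.2 hp.symm)
  have hn : ∀ x : ℝ, |y - p.im| ≤ ‖(x : ℂ) + y * I - p‖ := fun x => by
    simpa using Complex.abs_im_le_norm ((x : ℂ) + y * I - p)
  refine (integrable_exp_neg_abs.const_mul (K / |y - p.im|)).mono' ?_
    (Eventually.of_forall fun x => ?_)
  · refine Continuous.aestronglyMeasurable ((hF.continuous_line hy).div (by fun_prop) fun x => ?_)
    exact norm_pos_iff.1 (hd.trans_le (hn x))
  · rw [norm_div, div_mul_eq_mul_div]
    exact div_le_div₀ ((norm_nonneg _).trans (hF.bound x y hy)) (hF.bound x y hy) hd (hn x)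

/-- Shift of a Cauchy integral with the pole below the strip. -/
lemma integral_div_eq_of_im_neg (hF : DecaysOnStrip F δ K) (hδ : 0 ≤ δ) {p : ℂ} (hp : p.im < 0) :
    ∫ x : ℝ, F x / (x - p) = ∫ x : ℝ, F (x + δ * I) / (x + δ * I - p) := by
  have hne : ∀ w : ℂ, 0 ≤ w.im → w - p ≠ 0 := by
    intro w hw h
    have := congrArg Complex.im h
    simp at this
    linarith
  have h := integral_horizontal_line_eq (G := fun w => F w / (w - p)) hδ countable_empty
    (hF.continuousOn.div (by fun_prop) fun w hw => hne w hw.1)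
    (fun w hw _ => (hF.differentiableAt w hw).div (by fun_prop) (hne w hw.1.le))
    (tendsto_const_div_abs_sub K p.re) ?_
    (hF.integrable_line_div ⟨le_rfl, hδ⟩ hp.ne)
    (hF.integrable_line_div ⟨hδ, le_rfl⟩ (hp.trans_le hδ).ne)
  · simpa using h
  · filter_upwards [eventually_one_le_abs_sub p.re] with x hx y hy
    rw [norm_div]
    refine div_le_div₀ (hF.bound_nonneg hδ) (hF.norm_le hδ (by simpa using hy)) (by linarith) ?_
    simpa using Complex.abs_re_le_norm ((x : ℂ) + y * I - p)

/-- Shift of a Cauchy integral across a pole. -/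
lemma integral_div_add_residue (hF : DecaysOnStrip F δ K) {p : ℂ} (hp : 0 < p.im)
    (hpδ : p.im < δ) :
    (∫ x : ℝ, F x / (x - p)) - 2 * Real.pi * I * F p
      = ∫ x : ℝ, F (x + δ * I) / (x + δ * I - p) := by
  have hδ : 0 ≤ δ := (hp.trans hpδ).le
  set q : ℂ := starRingEnd ℂ p with hq
  -- The pole of F/(w − p) is removed by subtracting c/((w − p)(w − p̄)), with c chosen to match the
  -- residue. The second factor makes the correction integrable on horizontal lines avoiding p,
  -- which a constant multiple of 1/(w − p) would not be, and its own pole p̄ lies below the strip.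
  set c : ℂ := F p * (p - q) with hcdef
  have hqim : q.im = -p.im := by simp [hq]
  have hqre : q.re = p.re := by simp [hq]
  have hnq : ∀ w : ℂ, 0 ≤ w.im → w - q ≠ 0 := by
    intro w hw h
    have := congrArg Complex.im h
    simp [hqim] at this
    linarith
  have hnp : ∀ w : ℂ, w.im ≠ p.im → w - p ≠ 0 := by
    rintro w hw h
    exact hw (congrArg Complex.im (sub_eq_zero.1 h))
  set H : ℂ → ℂ := fun w => F w - c / (w - q) with hH
  have hHp : H p = 0 := by
    simp only [hH, hcdef]
    rw [mul_div_assoc, div_self (hnq p hp.le), mul_one, sub_self]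
  have hval : ∀ w : ℂ, w ≠ p → dslope H p w = F w / (w - p) - c * ((w - p) * (w - q))⁻¹ := by
    intro w hw
    rw [dslope_of_ne _ hw, slope_def_field, hHp, sub_zero]
    simp only [hH]
    rw [sub_div, div_div, mul_comm (w - q), ← div_eq_mul_inv]
  have hHc : ContinuousOn H {w | w.im ∈ Icc 0 δ} :=
    hF.continuousOn.sub (continuousOn_const.div (by fun_prop) fun w hw => hnq w hw.1)
  have hHd : ∀ w : ℂ, w.im ∈ Ioo 0 δ → DifferentiableAt ℂ H w := fun w hw =>
    (hF.differentiableAt w hw).sub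
      ((differentiableAt_const c).div (by fun_prop) (hnq w hw.1.le))
  have hnhds : {w : ℂ | w.im ∈ Icc 0 δ} ∈ 𝓝 p :=
    (Complex.continuous_im.tendsto p).eventually (Icc_mem_nhds hp hpδ)
  have hbd : ∀ w : ℂ, w.im ∈ Icc 0 δ → ‖H w‖ ≤ K + ‖c‖ / p.im := by
    intro w hw
    refine (norm_sub_le _ _).trans (add_le_add (hF.norm_le hδ hw) ?_)
    rw [norm_div]
    refine div_le_div_of_nonneg_left (norm_nonneg _) hp ?_
    have h := (le_abs_self _).trans (Complex.abs_im_le_norm (w - q))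
    simp only [Complex.sub_im, hqim] at h
    linarith [hw.1]
  have hi : ∀ y ∈ Icc 0 δ, y ≠ p.im →
      Integrable fun x : ℝ => (((x : ℂ) + y * I - p) * ((x : ℂ) + y * I - q))⁻¹ := by
    intro y hy hyp
    have e1 : ∀ x : ℝ, ‖(x : ℂ) + y * I - p‖ ^ 2 = (x - p.re) ^ 2 + |y - p.im| ^ 2 := by
      intro x; rw [sq_abs, Complex.sq_norm, Complex.normSq_apply]; simp; ring
    have e2 : ∀ x : ℝ, ‖(x : ℂ) + y * I - q‖ ^ 2 = (x - p.re) ^ 2 + (y + p.im) ^ 2 := by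
      intro x; rw [Complex.sq_norm, Complex.normSq_apply]; simp [hqim, hqre]; ring
    have hpos : 0 < |y - p.im| := abs_pos.2 (sub_ne_zero.2 hyp)
    refine (integrable_inv_sq_add_sq hpos p.re).mono' ?_ (Eventually.of_forall fun x => ?_)
    · refine Continuous.aestronglyMeasurable (Continuous.inv₀ (by fun_prop) fun x => ?_)
      exact mul_ne_zero (hnp _ (by simpa using hyp)) (hnq _ (by simpa using hy.1))
    · have h3 : ‖(x : ℂ) + y * I - p‖ ≤ ‖(x : ℂ) + y * I - q‖ := by
        refine (sq_le_sq₀ (norm_nonneg _) (norm_nonneg _)).1 ?_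
        rw [e1, e2, sq_abs]; nlinarith [mul_nonneg hy.1 hp.le]
      rw [norm_inv, norm_mul]
      refine inv_anti₀ (by positivity) ?_
      rw [← e1, sq]
      exact mul_le_mul_of_nonneg_left h3 (norm_nonneg _)
  have hline : ∀ y : ℝ, y ≠ p.im → ∀ x : ℝ, dslope H p (x + y * I)
      = F (x + y * I) / (x + y * I - p)
        - c * (((x : ℂ) + y * I - p) * ((x : ℂ) + y * I - q))⁻¹ := by
    intro y hy x
    refine hval _ fun h => hy ?_
    simpa using congrArg Complex.im h
  have hint : ∀ y ∈ Icc 0 δ, y ≠ p.im → Integrable fun x : ℝ => dslope H p (x + y * I) := by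
    intro y hy hyp
    simp_rw [hline y hyp]
    exact (hF.integrable_line_div hy hyp.symm).sub ((hi y hy hyp).const_mul c)
  have h0 : (0 : ℝ) ∈ Icc 0 δ := ⟨le_rfl, hδ⟩
  have h1 : δ ∈ Icc 0 δ := ⟨hδ, le_rfl⟩
  -- With {p} as the exceptional set, only continuity of the difference quotient is needed at p. The
  -- correction integrates to 0 on the upper line and to cπ/Im p = 2πi F(p) on the real line.
  have key := integral_horizontal_line_eq (G := dslope H p) hδ (countable_singleton p)
    ((continuousOn_dslope hnhds).2 ⟨hHc, hHd p ⟨hp, hpδ⟩⟩)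
    (fun w hw hwp => (differentiableAt_dslope_of_ne hwp).2 (hHd w hw))
    (tendsto_const_div_abs_sub (K + ‖c‖ / p.im) p.re) ?_ (hint 0 h0 hp.ne) (hint δ h1 hpδ.ne')
  · simp_rw [hline 0 hp.ne, hline δ hpδ.ne'] at key
    rw [integral_sub (hF.integrable_line_div h0 hp.ne') ((hi 0 h0 hp.ne).const_mul c),
      integral_sub (hF.integrable_line_div h1 hpδ.ne) ((hi δ h1 hpδ.ne').const_mul c),
      integral_const_mul, integral_const_mul, integral_inv_mul_conj_eq_zero hp hpδ] at key
    simp only [ofReal_zero, zero_mul, add_zero, mul_zero, sub_zero] at key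
    have e : ∫ x : ℝ, (((x : ℂ) - p) * ((x : ℂ) - q))⁻¹ = ((Real.pi / p.im : ℝ) : ℂ) := by
      rw [← integral_inv_sq_add_sq hp p.re, ← integral_complex_ofReal]
      congr 1
      funext x
      rw [hq, ofReal_inv]
      congr 1
      apply Complex.ext <;> simp [pow_two]; ring
    rw [e] at key
    rw [← key, hcdef]
    congr 1
    have e2 : p - q = 2 * p.im * I := by
      apply Complex.ext <;> simp [hqim, hqre]; ring
    have e3 : (p.im : ℂ) ≠ 0 := by exact_mod_cast hp.ne'
    rw [e2]
    push_cast
    field_simp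
  · filter_upwards [eventually_one_le_abs_sub p.re] with x hx y hy
    have hxp : (x : ℂ) + y * I ≠ p := by
      rintro h
      have := congrArg Complex.re h
      simp at this
      rw [this] at hx
      simp at hx
      linarith
    rw [dslope_of_ne _ hxp, slope_def_field, hHp, sub_zero, norm_div]
    refine div_le_div₀ ((norm_nonneg _).trans (hbd p ⟨hp.le, hpδ.le⟩))
      (hbd _ (by simpa using hy)) (by linarith) ?_
    simpa using Complex.abs_re_le_norm ((x : ℂ) + y * I - p)

end DecaysOnStrip

/-! ## Continuity of the continued resolvent -/

lemma Exp.continuousOn_ev (ψ : Exp) : ContinuousOn (fun w => Exp.ev w ψ) {w | 0 ≤ w.im} := by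
  obtain ⟨β, n, f, rfl⟩ := ψ.exists_incl
  obtain ⟨F, hF, hFf⟩ := f.2.1
  have hn : (0 : ℝ) < 1 / (n : ℝ) := one_div_pos.2 (by exact_mod_cast n.pos)
  refine (hF.differentiableOn.continuousOn.mono fun w (hw : 0 ≤ w.im) => ?_).congr
    fun w hw => ?_
  · change -(1 / (n : ℝ)) < w.im
    linarith
  · rw [Exp.ev_incl f hw, ← hFf]
    rfl

lemma Exp.differentiableAt_ev (ψ : Exp) {w : ℂ} (hw : 0 < w.im) :
    DifferentiableAt ℂ (fun w => Exp.ev w ψ) w := by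
  obtain ⟨β, n, f, rfl⟩ := ψ.exists_incl
  obtain ⟨F, hF, hFf⟩ := f.2.1
  have hn : (0 : ℝ) < 1 / (n : ℝ) := one_div_pos.2 (by exact_mod_cast n.pos)
  have hopen : IsOpen {w : ℂ | -(1 / (n : ℝ)) < w.im} :=
    isOpen_lt continuous_const Complex.continuous_im
  have hd : DifferentiableAt ℂ F w :=
    hF.differentiableOn.differentiableAt (hopen.mem_nhds (by change -(1 / (n : ℝ)) < w.im; linarith))
  refine hd.congr_of_eventuallyEq ?_
  filter_upwards [(isOpen_lt continuous_const Complex.continuous_im).mem_nhds hw] with v hv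
  rw [Exp.ev_incl f (le_of_lt hv), ← hFf]
  rfl

lemma norm_gauss (ω₀ h x y : ℝ) : ‖gauss ω₀ h (x + y * I)‖
    = Real.sqrt (h / Real.pi) * Real.exp (h * y ^ 2) * Real.exp (-h * (x - ω₀) ^ 2) := by
  rw [gauss, norm_mul, Complex.norm_real, Real.norm_eq_abs, abs_of_nonneg (Real.sqrt_nonneg _),
    Complex.norm_exp, mul_assoc, ← Real.exp_add]
  congr 2
  simp [pow_two]
  ring

/-- Completing the square: (|B + 1| − 2h|x − ω₀|)² ≥ 0 bounds the linear exponent by the Gaussian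
one, and |x| ≤ |x − ω₀| + |ω₀| accounts for the remaining constant. -/
lemma exp_mul_abs_mul_exp_neg_sq_le (ω₀ : ℝ) {h : ℝ} (hh : 0 < h) (B : ℝ) :
    ∃ K, 0 ≤ K ∧ ∀ x : ℝ, Real.exp (B * |x|) * Real.exp (-h * (x - ω₀) ^ 2)
      ≤ K * Real.exp (-|x|) := by
  refine ⟨Real.exp (|B + 1| ^ 2 / (4 * h) + |B + 1| * |ω₀|), by positivity, fun x => ?_⟩
  rw [← Real.exp_add, ← Real.exp_add, Real.exp_le_exp]
  have h1 : |x| ≤ |x - ω₀| + |ω₀| := by simpa using abs_add_le (x - ω₀) ω₀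
  have h2 : (B + 1) * |x| ≤ |B + 1| * (|x - ω₀| + |ω₀|) :=
    mul_le_mul (le_abs_self _) h1 (abs_nonneg _) (abs_nonneg _)
  have h3 : |B + 1| * |x - ω₀| ≤ |B + 1| ^ 2 / (4 * h) + h * (x - ω₀) ^ 2 := by
    rw [← sq_abs (x - ω₀), ← sub_nonneg]
    have : |B + 1| ^ 2 / (4 * h) + h * |x - ω₀| ^ 2 - |B + 1| * |x - ω₀|
        = (|B + 1| - 2 * h * |x - ω₀|) ^ 2 / (4 * h) := by field_simp; ring
    rw [this]
    positivity
  linarith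

/-- The integrand `ψ φ g` of the pairing on the closed upper half-plane. -/
noncomputable def pairingDensity (ω₀ h : ℝ) (ψ φ : Exp) (w : ℂ) : ℂ :=
  Exp.ev w ψ * Exp.ev w φ * gauss ω₀ h w

/-- On a strip of height δ the Gaussian loses at most the factor e^{hδ²}, so its decay in the real
direction still beats the exponential growth of ψφ. This makes every contour shift below legitimate.
-/
lemma decaysOnStrip_pairingDensity (ω₀ : ℝ) {h : ℝ} (hh : 0 < h) (ψ φ : Exp) (δ : ℝ) :
    ∃ K, DecaysOnStrip (pairingDensity ω₀ h ψ φ) δ K := by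
  have hg : Differentiable ℂ (gauss ω₀ h) := by
    unfold gauss
    fun_prop
  obtain ⟨β, n, f, hf⟩ := ψ.exists_incl
  obtain ⟨β', n', f', hf'⟩ := φ.exists_incl
  obtain ⟨K, hK0, hK⟩ := exp_mul_abs_mul_exp_neg_sq_le ω₀ hh (β + β')
  refine ⟨‖f‖ * ‖f'‖ * Real.exp ((β + β') * δ) * Real.sqrt (h / Real.pi) * Real.exp (h * δ ^ 2)
    * K, ?_, ?_, ?_⟩
  · exact (((Exp.continuousOn_ev ψ).mul (Exp.continuousOn_ev φ)).mul
      hg.continuous.continuousOn).mono fun w hw => hw.1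
  · exact fun w hw => ((Exp.differentiableAt_ev ψ hw.1).mul (Exp.differentiableAt_ev φ hw.1)).mul
      (hg w)
  · intro x y hy
    have him : 0 ≤ ((x : ℂ) + y * I).im := by simpa using hy.1
    have hno : ‖(x : ℂ) + y * I‖ ≤ |x| + δ := by
      refine (norm_add_le _ _).trans ?_
      rw [norm_mul, norm_I, Complex.norm_real, Complex.norm_real, mul_one, Real.norm_eq_abs,
        Real.norm_eq_abs, abs_of_nonneg hy.1]
      linarith [hy.2]
    have h1 : ‖Exp.ev (x + y * I) ψ‖ ≤ ‖f‖ * Real.exp (β * (|x| + δ)) := by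
      rw [← hf]
      refine (Exp.norm_ev_incl_le f him).trans ?_
      have := f.norm_nonneg'
      gcongr
    have h2 : ‖Exp.ev (x + y * I) φ‖ ≤ ‖f'‖ * Real.exp (β' * (|x| + δ)) := by
      rw [← hf']
      refine (Exp.norm_ev_incl_le f' him).trans ?_
      have := f'.norm_nonneg'
      gcongr
    have h3 : ‖gauss ω₀ h (x + y * I)‖ ≤ Real.sqrt (h / Real.pi) * Real.exp (h * δ ^ 2)
        * Real.exp (-h * (x - ω₀) ^ 2) := by
      rw [norm_gauss]
      have := hy.1
      have := hy.2
      gcongr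
    rw [pairingDensity, norm_mul, norm_mul]
    calc _ ≤ (‖f‖ * Real.exp (β * (|x| + δ))) * (‖f'‖ * Real.exp (β' * (|x| + δ)))
          * (Real.sqrt (h / Real.pi) * Real.exp (h * δ ^ 2) * Real.exp (-h * (x - ω₀) ^ 2)) := by
            gcongr
      _ = ‖f‖ * ‖f'‖ * Real.exp ((β + β') * δ) * Real.sqrt (h / Real.pi) * Real.exp (h * δ ^ 2)
          * (Real.exp ((β + β') * |x|) * Real.exp (-h * (x - ω₀) ^ 2)) := by
            have e : Real.exp (β * (|x| + δ)) * Real.exp (β' * (|x| + δ))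
                = Real.exp ((β + β') * δ) * Real.exp ((β + β') * |x|) := by
              rw [← Real.exp_add, ← Real.exp_add]
              congr 1
              ring
            linear_combination ‖f‖ * ‖f'‖ * Real.sqrt (h / Real.pi) * Real.exp (h * δ ^ 2) *
              Real.exp (-h * (x - ω₀) ^ 2) * e
      _ ≤ _ := by
            rw [mul_assoc _ K]
            have := f.norm_nonneg'
            have := f'.norm_nonneg'
            have := hK x
            gcongr

/-- The Cauchy integral over the line `Im w = δ`. -/
noncomputable def shiftedCauchyForm (ω₀ h δ : ℝ) (z : ℂ) (ψ φ : Exp) : ℂ :=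
  ∫ ω : ℝ, (z + δ - I * ω)⁻¹ * pairingDensity ω₀ h ψ φ (ω + δ * I)

lemma inv_kernel_eq (z w : ℂ) : (z - I * w)⁻¹ = I * (w - z / I)⁻¹ := by
  have e : z - I * w = -I * (w - z / I) := by
    rw [Complex.div_I]
    linear_combination z * I_sq
  rw [e, mul_inv, inv_neg, inv_I, neg_neg]

lemma cauchyForm_eq_integral_div (ω₀ h : ℝ) (z : ℂ) (ψ φ : Exp) :
    cauchyForm ω₀ h z ψ φ = I * ∫ x : ℝ, pairingDensity ω₀ h ψ φ x / (x - z / I) := by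
  rw [cauchyForm, ← integral_const_mul]
  congr 1
  funext x
  rw [inv_kernel_eq, pairingDensity]
  ring

lemma shiftedCauchyForm_eq_integral_div (ω₀ h δ : ℝ) (z : ℂ) (ψ φ : Exp) :
    shiftedCauchyForm ω₀ h δ z ψ φ
      = I * ∫ x : ℝ, pairingDensity ω₀ h ψ φ (x + δ * I) / (x + δ * I - z / I) := by
  rw [shiftedCauchyForm, ← integral_const_mul]
  congr 1
  funext x
  have e : z + δ - I * x = z - I * (x + δ * I) := by linear_combination (δ : ℂ) * I_sq
  rw [e, inv_kernel_eq]
  ring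

lemma continuousAt_shiftedCauchyForm (ω₀ : ℝ) {h : ℝ} (hh : 0 < h) {δ : ℝ} (hδ : 0 ≤ δ) {z : ℂ}
    (hz : -δ < z.re) (ψ φ : Exp) :
    ContinuousAt (fun z => shiftedCauchyForm ω₀ h δ z ψ φ) z := by
  obtain ⟨K, hF⟩ := decaysOnStrip_pairingDensity ω₀ hh ψ φ δ
  -- The pole z/i has distance Re z + δ from the line Im w = δ. Half of it serves as a uniform lower
  -- bound for the denominator near z.
  set r : ℝ := (z.re + δ) / 2 with hr
  have hr0 : 0 < r := by rw [hr]; linarith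
  have hδm : δ ∈ Icc 0 δ := ⟨hδ, le_rfl⟩
  have hre : ∀ᶠ v : ℂ in 𝓝 z, r < v.re + δ :=
    ((Complex.continuous_re.add continuous_const).tendsto z).eventually
      (lt_mem_nhds (by simp only [Pi.add_apply]; linarith))
  refine continuousAt_of_dominated (bound := fun x => r⁻¹ * (K * Real.exp (-|x|))) ?_ ?_
    ((integrable_exp_neg_abs.const_mul K).const_mul _) ?_
  · refine Eventually.of_forall fun v => AEStronglyMeasurable.mul ?_
      (hF.continuous_line hδm).aestronglyMeasurable
    exact (by fun_prop : Measurable fun ω : ℝ => (v + δ - I * ω)⁻¹).aestronglyMeasurable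
  · filter_upwards [hre] with v hv
    refine Eventually.of_forall fun x => ?_
    rw [norm_mul, norm_inv]
    have h1 : r ≤ ‖v + δ - I * x‖ := by
      have := (le_abs_self _).trans (Complex.abs_re_le_norm (v + δ - I * x))
      simp at this
      linarith
    exact mul_le_mul (inv_anti₀ hr0 h1) (hF.bound x δ hδm) (norm_nonneg _) (by positivity)
  · refine Eventually.of_forall fun x => ContinuousAt.mul (ContinuousAt.inv₀ (by fun_prop) ?_)
      continuousAt_const
    intro h0
    have := congrArg Complex.re h0
    simp at this
    linarith

/-- The pairing `⟨A(z) kap ψ | φ⟩` is a single Cauchy integral over a shifted line. -/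
lemma resolventForm_eq_shiftedCauchyForm (ω₀ : ℝ) {h : ℝ} (hh : 0 < h) {δ : ℝ} (hδ : 0 < δ)
    {z : ℂ} (hz : -δ < z.re) (ψ φ : Exp) :
    resolventForm ω₀ h z ψ φ = shiftedCauchyForm ω₀ h δ z ψ φ := by
  obtain ⟨K, hF⟩ := decaysOnStrip_pairingDensity ω₀ hh ψ φ δ
  have him : ∀ z : ℂ, (z / I).im = -z.re := fun z => by rw [Complex.div_I]; simp
  have hpos : ∀ z : ℂ, 0 < z.re →
      cauchyForm ω₀ h z ψ φ = shiftedCauchyForm ω₀ h δ z ψ φ := by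
    intro z hz
    rw [cauchyForm_eq_integral_div, shiftedCauchyForm_eq_integral_div,
      hF.integral_div_eq_of_im_neg hδ.le (by rw [him]; linarith)]
  -- The pole z/i has imaginary part −Re z < δ. For Re z > 0 it lies below the strip and nothing is
  -- crossed; for Re z < 0 it lies inside, and its residue is the extra term in the definition; on
  -- the imaginary axis both sides are limits from the right.
  rcases lt_trichotomy z.re 0 with h0 | h0 | h0
  · rw [resolventForm, if_neg h0.le.not_gt, if_neg h0.ne, cauchyForm_eq_integral_div,
      shiftedCauchyForm_eq_integral_div,
      ← hF.integral_div_add_residue (p := z / I) (by rw [him]; linarith) (by rw [him]; linarith)]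
    change _ + 2 * (Real.pi : ℂ) * pairingDensity ω₀ h ψ φ (z / I) = _
    linear_combination (2 * Real.pi * pairingDensity ω₀ h ψ φ (z / I)) * I_sq
  · refine tendsto_nhds_unique (tendsto_resolventForm ω₀ hh h0 ψ φ) ?_
    have hc := continuousAt_shiftedCauchyForm ω₀ hh hδ.le hz ψ φ
    have ht : Tendsto (fun ε : ℝ => z + ε) (𝓝[>] (0 : ℝ)) (𝓝 z) := by
      have : Tendsto (fun ε : ℝ => z + ε) (𝓝 (0 : ℝ)) (𝓝 (z + (0 : ℝ))) :=
        Continuous.tendsto (by fun_prop) 0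
      rw [ofReal_zero, add_zero] at this
      exact this.mono_left nhdsWithin_le_nhds
    refine (hc.tendsto.comp ht).congr' ?_
    filter_upwards [self_mem_nhdsWithin] with ε hε
    exact (hpos _ (by simpa [h0] using hε)).symm
  · rw [resolventForm, if_pos h0, hpos z h0]

/-- Near each z the case distinction disappears once the line is raised to height |Re z| + 1, so
nothing jumps at the imaginary axis. -/
lemma continuous_resolventForm (ω₀ : ℝ) {h : ℝ} (hh : 0 < h) (ψ φ : Exp) :
    Continuous fun z => resolventForm ω₀ h z ψ φ := by
  refine continuous_iff_continuousAt.2 fun z => ?_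
  have hδ : 0 < |z.re| + 1 := by positivity
  have hz : -(|z.re| + 1) < z.re := by linarith [neg_abs_le z.re]
  refine (continuousAt_shiftedCauchyForm ω₀ hh hδ.le hz ψ φ).congr ?_
  filter_upwards [(isOpen_lt continuous_const Complex.continuous_re).mem_nhds hz] with v hv
  exact (resolventForm_eq_shiftedCauchyForm ω₀ hh hδ hv ψ φ).symm

/-! ## Generalized spectra for perturbations of rank one -/

section RankOne

variable {X : Type*} [AddCommGroup X] [Module ℂ X] [TopologicalSpace X]
  {kap : X →ₗ[ℂ] WeakDual ℂ X} {A : ℂ → X →ₗ[ℂ] WeakDual ℂ X}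
  {Kx : WeakDual ℂ X →ₗ[ℂ] WeakDual ℂ X} {τ : ℝ} {a : ℂ} {e : X}

/-- The function whose zeros are the generalized eigenvalues. -/
noncomputable def charFun (A : ℂ → X →ₗ[ℂ] WeakDual ℂ X) (τ : ℝ) (a : ℂ) (e : X) (z : ℂ) : ℂ :=
  1 - a * Complex.exp (-(z * τ)) * A z e e

/-- As `Kx` has range in the span of κe, the characteristic operator factors through κ and a
rank-one perturbation of the identity of X; inverting it becomes scalar algebra. -/
lemma charOp_apply (hK : ∀ u, Kx u = (a * u e) • kap e) (z : ℂ) (ψ : X) :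
    charOp kap A Kx τ z ψ = kap (ψ - (a * Complex.exp (-(z * τ)) * A z ψ e) • e) := by
  rw [map_sub, map_smul]
  change kap ψ - Complex.exp (-(z * τ)) • Kx (A z ψ) = _
  rw [hK, smul_smul]
  congr 2
  ring

lemma pairing_add_smul (z b : ℂ) (ψ : X) : A z (ψ + b • e) e = A z ψ e + b * A z e e := by
  rw [map_add, map_smul]
  rfl

/-- The preimage of `kap ψ` under the characteristic operator. -/
noncomputable def charOpInv (A : ℂ → X →ₗ[ℂ] WeakDual ℂ X) (τ : ℝ) (a : ℂ) (e : X) (z : ℂ)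
    (ψ : X) : X :=
  ψ + (a * Complex.exp (-(z * τ)) * A z ψ e / charFun A τ a e z) • e

lemma charOp_charOpInv (hK : ∀ u, Kx u = (a * u e) • kap e) {z : ℂ}
    (hz : charFun A τ a e z ≠ 0) (ψ : X) :
    charOp kap A Kx τ z (charOpInv A τ a e z ψ) = kap ψ := by
  rw [charOp_apply hK, charOpInv, pairing_add_smul, add_sub_assoc, ← sub_smul]
  have : a * Complex.exp (-(z * τ)) * A z ψ e / charFun A τ a e z
      - a * Complex.exp (-(z * τ)) * (A z ψ e
        + a * Complex.exp (-(z * τ)) * A z ψ e / charFun A τ a e z * A z e e) = 0 := by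
    field_simp
    simp only [charFun]
    ring
  rw [this, zero_smul, add_zero]

/-- A kernel element must be a multiple b·e, and pairing with e leaves b·f(z) = 0 for the
characteristic function f. Conversely, if f(z) = 0 then e is in the kernel, and e ≠ 0 because its
pairing ⟨A(z)κe|e⟩ is nonzero. -/
lemma injective_charOp_iff (hkap : Function.Injective kap)
    (hK : ∀ u, Kx u = (a * u e) • kap e) {z : ℂ} :
    Function.Injective (charOp kap A Kx τ z) ↔ charFun A τ a e z ≠ 0 := by
  constructor
  · intro hinj h0
    have h1 : a * Complex.exp (-(z * τ)) * A z e e = 1 := (sub_eq_zero.1 h0).symm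
    have h2 : charOp kap A Kx τ z e = charOp kap A Kx τ z 0 := by
      rw [charOp_apply hK, h1, one_smul, sub_self, map_zero, map_zero]
    have h3 : A z e e = 0 := by
      rw [hinj h2, map_zero]
    rw [h3, mul_zero] at h1
    exact zero_ne_one h1
  · intro hz
    refine (injective_iff_map_eq_zero _).2 fun ψ hψ => ?_
    rw [charOp_apply hK] at hψ
    have h1 := sub_eq_zero.1 (hkap (hψ.trans (map_zero kap).symm))
    set b := a * Complex.exp (-(z * τ)) * A z ψ e with hb
    have h2 : A z ψ e = b * A z e e := by
      conv_lhs => rw [h1, map_smul]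
      rfl
    have h3 : b * charFun A τ a e z = 0 := by
      rw [charFun]
      rw [h2] at hb
      linear_combination hb
    rw [h1, (mul_eq_zero.1 h3).resolve_right hz, zero_smul]

lemma resolventDomain_eq_top (hK : ∀ u, Kx u = (a * u e) • kap e) {z : ℂ}
    (hz : charFun A τ a e z ≠ 0) : resolventDomain kap A Kx τ z = ⊤ :=
  eq_top_iff.2 fun ψ _ => ⟨charOpInv A τ a e z ψ, charOp_charOpInv hK hz ψ⟩

lemma retardedResolvent_apply (hK : ∀ u, Kx u = (a * u e) • kap e) {z : ℂ}
    (hz : charFun A τ a e z ≠ 0) (hinj : Function.Injective (charOp kap A Kx τ z))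
    (ψ : resolventDomain kap A Kx τ z) (φ : X) :
    retardedResolvent kap A Kx τ z hinj ψ φ = A z ψ φ
      + a * Complex.exp (-(z * τ)) * A z ψ e / charFun A τ a e z * A z e φ := by
  have h1 : (LinearEquiv.ofInjective (charOp kap A Kx τ z) hinj).symm
      (kap.restrict (p := resolventDomain kap A Kx τ z)
        (q := LinearMap.range (charOp kap A Kx τ z)) (fun _ hψ => hψ) ψ)
      = charOpInv A τ a e z ψ := by
    rw [LinearEquiv.symm_apply_eq]
    exact Subtype.ext (charOp_charOpInv hK hz (ψ : X)).symm
  change A z ((LinearEquiv.ofInjective (charOp kap A Kx τ z) hinj).symm _) φ = _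
  rw [h1, charOpInv, map_add, map_smul]
  rfl

/-- The eigenvector equation makes x a multiple of A(z)κe with coefficient proportional to ⟨x|e⟩,
which therefore cannot vanish. Pairing with e gives ⟨x|e⟩f(z) = 0. At a zero of f, A(z)κe itself is
an eigenvector. -/
lemma isGenEigenvalue_iff (hkap : Function.Injective kap)
    (hK : ∀ u, Kx u = (a * u e) • kap e) {z : ℂ} :
    IsGenEigenvalue kap A Kx τ z ↔ charFun A τ a e z = 0 := by
  constructor
  · rintro ⟨x, -, hx0, ξ, hξ, hx⟩
    rw [hK, ← map_smul] at hξ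
    rw [← hkap hξ, map_smul, sub_eq_zero, smul_smul] at hx
    have h1 : x e = Complex.exp (-(z * τ)) * (a * x e) * A z e e := by
      conv_lhs => rw [hx]
      rfl
    have hxe : x e ≠ 0 := by
      intro h0
      rw [h0, mul_zero, mul_zero, zero_smul] at hx
      exact hx0 hx
    refine (mul_eq_zero.1 ?_).resolve_left hxe
    rw [charFun]
    linear_combination h1
  · intro h0
    have h1 : a * Complex.exp (-(z * τ)) * A z e e = 1 := (sub_eq_zero.1 h0).symm
    refine ⟨A z e, ⟨e, rfl⟩, ?_, (a * A z e e) • e, ?_, ?_⟩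
    · intro h
      rw [h] at h1
      change _ * (0 : ℂ) = 1 at h1
      rw [mul_zero] at h1
      exact zero_ne_one h1
    · rw [hK, map_smul]
    · have h2 : Complex.exp (-(z * τ)) * (a * A z e e) = 1 := by rw [← h1]; ring
      rw [map_smul, smul_smul, h2, one_smul, sub_self]

lemma genResidualSpectrum_eq_empty (hkap : Function.Injective kap)
    (hK : ∀ u, Kx u = (a * u e) • kap e) : genResidualSpectrum kap A Kx τ = ∅ := by
  refine eq_empty_of_forall_notMem fun z hz => hz.2 ?_
  rw [resolventDomain_eq_top hK ((injective_charOp_iff hkap hK).1 hz.1)]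
  exact dense_univ

lemma isVonNBounded_weakDual_iff {S : Set (WeakDual ℂ X)} [IsTopologicalAddGroup X]
    [ContinuousSMul ℂ X] :
    Bornology.IsVonNBounded ℂ S ↔ ∀ φ : X, ∃ r > 0, ∀ u ∈ S, ‖u φ‖ < r :=
  (LinearMap.weakBilin_withSeminorms (topDualPairing ℂ X)).isVonNBounded_iff_seminorm_bounded

/-- Nonvanishing of the characteristic function is an open condition, and where it holds the
resolvent is given by a formula continuous in z, hence bounded on compact sets after pairing with
any φ. -/
lemma genSpectrum_eq_genPointSpectrum [IsTopologicalAddGroup X] [ContinuousSMul ℂ X]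
    (hkap : Function.Injective kap) (hK : ∀ u, Kx u = (a * u e) • kap e)
    (hA : ∀ ψ φ, Continuous fun z => A z ψ φ) (hsymm : ∀ z ψ φ, A z ψ φ = A z φ ψ) :
    genSpectrum kap A Kx τ = genPointSpectrum kap A Kx τ := by
  have hcf : Continuous (charFun A τ a e) := by
    have := hA e e
    unfold charFun
    fun_prop
  -- Symmetry of the pairing moves ψ into the slot where continuity is built in, since `A z φ`
  -- belongs to X'.
  have hψc : ∀ z φ, Continuous fun ψ : X => A z ψ φ := fun z φ => by
    simp_rw [hsymm z _ φ]
    exact map_continuous (A z φ)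
  ext z
  rw [genSpectrum, mem_compl_iff, genPointSpectrum, mem_ofPred_eq, isGenEigenvalue_iff hkap hK,
    not_iff_comm]
  constructor
  · intro hz
    -- One compact neighborhood serves all ψ; compactness supplies the bound for each pair ψ, φ.
    obtain ⟨V, hV, hVsub, hVc⟩ := local_compact_nhds (hcf.continuousAt.eventually_ne hz)
    have hne : ∀ μ ∈ V, charFun A τ a e μ ≠ 0 := fun μ hμ => hVsub hμ
    refine ⟨V, hV, fun μ hμ => ⟨(injective_charOp_iff hkap hK).2 (hne μ hμ), ?_, ?_⟩, fun ψ => ?_⟩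
    · rw [resolventDomain_eq_top hK (hne μ hμ)]
      exact dense_univ
    · refine WeakDual.continuous_of_continuous_eval fun φ => ?_
      simp_rw [retardedResolvent_apply hK (hne μ hμ)]
      have h1 := (hψc μ φ).comp (continuous_subtype_val (p := (· ∈ resolventDomain kap A Kx τ μ)))
      have h2 := (hψc μ e).comp (continuous_subtype_val (p := (· ∈ resolventDomain kap A Kx τ μ)))
      simp only [Function.comp_def] at h1 h2
      fun_prop
    · refine isVonNBounded_weakDual_iff.2 fun φ => ?_
      have hcont : ContinuousOn (fun μ => A μ ψ φ
          + a * Complex.exp (-(μ * τ)) * A μ ψ e / charFun A τ a e μ * A μ e φ) V := by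
        have h1 := hA ψ φ
        have h2 := hA ψ e
        have h3 := hA e φ
        exact h1.continuousOn.add (((by fun_prop : Continuous fun μ : ℂ =>
          a * Complex.exp (-(μ * τ)) * A μ ψ e).continuousOn.div hcf.continuousOn hne).mul
            h3.continuousOn)
      obtain ⟨C, hC⟩ := hVc.exists_bound_of_continuousOn hcont
      refine ⟨|C| + 1, by positivity, ?_⟩
      rintro _ ⟨μ, hμ, hinj, hψ, rfl⟩
      rw [retardedResolvent_apply hK (hne μ hμ)]
      linarith [hC μ hμ, le_abs_self C]
  · rintro ⟨V, hV, hVR, -⟩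
    obtain ⟨hinj, -⟩ := hVR z (mem_of_mem_nhds hV)
    exact (injective_charOp_iff hkap hK).1 hinj

end RankOne

/-! ## The generalized spectrum of the delayed Kuramoto linearization -/

lemma kappa_apply (ω₀ : ℝ) {h : ℝ} (hh : 0 < h) (ψ φ : Exp) :
    kappa ω₀ hh ψ φ = ∫ ω : ℝ, Exp.ev (ω : ℂ) ψ * Exp.ev (ω : ℂ) φ * gauss ω₀ h (ω : ℂ) := rfl

lemma resolventOp_apply (ω₀ : ℝ) {h : ℝ} (hh : 0 < h) (z : ℂ) (ψ φ : Exp) :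
    resolventOp ω₀ hh z ψ φ = resolventForm ω₀ h z ψ φ := rfl

lemma dualOp_couplingOp (k ω₀ : ℝ) {h : ℝ} (hh : 0 < h) (u : WeakDual ℂ Exp) :
    dualOp (couplingOp k ω₀ hh) u
      = (((k / 2 : ℝ) : ℂ) * u Exp.one) • kappa ω₀ hh Exp.one := by
  refine DFunLike.ext _ _ fun φ => ?_
  change u (couplingOp k ω₀ hh φ) = ((k / 2 : ℝ) : ℂ) * u Exp.one * kappa ω₀ hh Exp.one φ
  have h1 : couplingOp k ω₀ hh φ
      = ((k / 2 : ℝ) : ℂ) • kappa ω₀ hh Exp.one φ • Exp.one := rfl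
  rw [h1, map_smul, map_smul, smul_eq_mul, smul_eq_mul]
  ring

/-- Exponential growth is allowed in every direction, so all characters e^{itω} are available as
test functions, with type β = ⌈|t|⌉. -/
lemma Exp.exists_ev_eq_cexp (t : ℝ) :
    ∃ φ : Exp, ∀ ω : ℝ, Exp.ev (ω : ℂ) φ = Complex.exp (t * ω * I) := by
  let f : ExpStep ⌈|t|⌉₊ 1 := ⟨fun z => Complex.exp (t * z * I),
    ⟨fun z => Complex.exp (t * z * I), Differentiable.diffContOnCl (by fun_prop), fun _ => rfl⟩,
    ⟨1, by
      rintro _ ⟨z, rfl⟩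
      have h1 : (t * (z : ℂ) * I).re ≤ ⌈|t|⌉₊ * ‖(z : ℂ)‖ := by
        refine (Complex.re_le_norm _).trans ?_
        rw [norm_mul, norm_mul, norm_I, mul_one, Complex.norm_real, Real.norm_eq_abs]
        exact mul_le_mul_of_nonneg_right (Nat.le_ceil _) (norm_nonneg _)
      simp only
      rw [Complex.norm_exp, ← Real.exp_add, Real.exp_le_one_iff]
      linarith⟩⟩
  exact ⟨Exp.incl _ _ f, fun ω => Exp.ev_incl f (by simp)⟩

lemma Exp.eq_zero_of_ev_real (ψ : Exp) (hψ : ∀ ω : ℝ, Exp.ev (ω : ℂ) ψ = 0) : ψ = 0 := by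
  obtain ⟨β, n, f, rfl⟩ := ψ.exists_incl
  obtain ⟨F, hF, hFf⟩ := f.2.1
  have hn : (0 : ℝ) < 1 / (n : ℝ) := one_div_pos.2 (by exact_mod_cast n.pos)
  have hopen : IsOpen {w : ℂ | -(1 / (n : ℝ)) < w.im} :=
    isOpen_lt continuous_const Complex.continuous_im
  have hF0 : ∀ ω : ℝ, F ω = 0 := by
    intro ω
    have h1 := hψ ω
    rw [Exp.ev_incl f (by simp), ← hFf] at h1
    exact h1
  have hfreq : ∃ᶠ z in 𝓝[≠] (0 : ℂ), F z = 0 := by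
    have ht : Tendsto (fun x : ℝ => (x : ℂ)) (𝓝[≠] 0) (𝓝[≠] 0) := by
      refine tendsto_nhdsWithin_iff.2 ⟨?_, ?_⟩
      · exact (Complex.continuous_ofReal.tendsto' 0 0 ofReal_zero :
          Tendsto (fun x : ℝ => (x : ℂ)) (𝓝 0) (𝓝 0)).mono_left nhdsWithin_le_nhds
      · filter_upwards [self_mem_nhdsWithin] with x hx
        simp_all
    exact ht.frequently (Eventually.of_forall hF0).frequently
  have hzero := (hF.differentiableOn.analyticOnNhd hopen).eqOn_zero_of_preconnected_of_frequently_eq_zero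
    (convex_halfSpace_im_gt _).isPreconnected (by simp) hfreq
  refine Subtype.ext (funext fun z => ?_)
  change f.1 (UpperClosed.toHalfPlane n z) = 0
  rw [← hFf]
  exact hzero (lt_of_lt_of_le (by linarith) z.2 : -(1 / (n : ℝ)) < z.1.im)

/-- Testing κψ = 0 against characters says that the Fourier transform of the continuous integrable
function ψg vanishes. Inversion gives ψg = 0, the Gaussian has no zeros, and the identity theorem
extends ψ = 0 off the real line. -/
lemma injective_kappa (ω₀ : ℝ) {h : ℝ} (hh : 0 < h) : Function.Injective (kappa ω₀ hh) := by
  refine (injective_iff_map_eq_zero _).2 fun ψ hψ => Exp.eq_zero_of_ev_real ψ fun ω => ?_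
  set f : ℝ → ℂ := fun ω => Exp.ev (ω : ℂ) ψ * gauss ω₀ h (ω : ℂ) with hf
  have hfc : Continuous f :=
    (Exp.continuous_ev ψ).mul ((gauss_continuous ω₀ h).comp Complex.continuous_ofReal)
  have hfi : Integrable f := by
    refine (integrable_prod ω₀ hh ψ Exp.one).congr (Eventually.of_forall fun x => ?_)
    simp only [hf]
    rw [Exp.ev_one (by simp), mul_one]
  have hF : FourierTransform.fourier f = 0 := by
    funext w
    obtain ⟨φ, hφ⟩ := Exp.exists_ev_eq_cexp (-2 * Real.pi * w)
    rw [Real.fourier_real_eq_integral_exp_smul]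
    have h1 : kappa ω₀ hh ψ φ = 0 := by
      rw [hψ]
      rfl
    rw [kappa_apply] at h1
    rw [Pi.zero_apply, ← h1]
    congr 1
    funext v
    rw [hφ, smul_eq_mul]
    simp only [hf]
    have e : ((-2 * Real.pi * v * w : ℝ) : ℂ) * I = ((-2 * Real.pi * w : ℝ) : ℂ) * v * I := by
      push_cast
      ring
    rw [e]
    ring
  have h2 := hfc.fourierInv_fourier_eq hfi (by rw [hF]; exact integrable_zero _ _ _)
  have h3 : f ω = 0 := by
    rw [← h2, hF, Real.fourierInv_eq]
    simp
  refine (mul_eq_zero.1 h3).resolve_right ?_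
  rw [gauss]
  refine mul_ne_zero ?_ (Complex.exp_ne_zero _)
  exact_mod_cast (Real.sqrt_pos.2 (div_pos hh Real.pi_pos)).ne'

lemma spectrumKM_eq (k ω₀ τ : ℝ) {h : ℝ} (hh : 0 < h) :
    spectrumKM k ω₀ τ hh = pointSpectrumKM k ω₀ τ hh :=
  genSpectrum_eq_genPointSpectrum (injective_kappa ω₀ hh) (dualOp_couplingOp k ω₀ hh)
    (fun ψ φ => continuous_resolventForm ω₀ hh ψ φ) (fun z ψ φ => resolventForm_comm ω₀ h z ψ φ)

lemma residualSpectrumKM_eq_empty (k ω₀ τ : ℝ) {h : ℝ} (hh : 0 < h) :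
    residualSpectrumKM k ω₀ τ hh = ∅ :=
  genResidualSpectrum_eq_empty (injective_kappa ω₀ hh) (dualOp_couplingOp k ω₀ hh)

lemma continuousSpectrumKM_eq_empty (k ω₀ τ : ℝ) {h : ℝ} (hh : 0 < h) :
    continuousSpectrumKM k ω₀ τ hh = ∅ := by
  change spectrumKM k ω₀ τ hh \ (pointSpectrumKM k ω₀ τ hh ∪ residualSpectrumKM k ω₀ τ hh) = ∅
  rw [spectrumKM_eq]
  exact sdiff_eq_empty.2 subset_union_left

lemma mem_pointSpectrumKM_iff (k ω₀ τ : ℝ) {h : ℝ} (hh : 0 < h) {z : ℂ} :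
    z ∈ pointSpectrumKM k ω₀ τ hh ↔ ((k / 2 : ℝ) : ℂ) * Complex.exp (-(z * τ))
      * resolventForm ω₀ h z Exp.one Exp.one = 1 := by
  refine (isGenEigenvalue_iff (injective_kappa ω₀ hh) (dualOp_couplingOp k ω₀ hh)).trans ?_
  rw [charFun, resolventOp_apply, sub_eq_zero, eq_comm]

/-! ## The dispersion function of the Gaussian density -/

lemma pairingDensity_one (ω₀ h : ℝ) {w : ℂ} (hw : 0 ≤ w.im) :
    pairingDensity ω₀ h Exp.one Exp.one w = gauss ω₀ h w := by
  rw [pairingDensity, Exp.ev_one hw, one_mul, one_mul]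

lemma shiftedCauchyForm_one (ω₀ h : ℝ) {δ : ℝ} (hδ : 0 ≤ δ) (z : ℂ) :
    shiftedCauchyForm ω₀ h δ z Exp.one Exp.one
      = ∫ ω : ℝ, (z + δ - I * ω)⁻¹ * gauss ω₀ h (ω + δ * I) := by
  rw [shiftedCauchyForm]
  congr 1
  funext ω
  rw [pairingDensity_one _ _ (by simpa using hδ)]

/-- The continuation of `∫ g(ω) / (ζ - iω) dω` for the normalized Gaussian density
`g(ω) = e^{-ω²} / √π`. -/
noncomputable def dispersion (ζ : ℂ) : ℂ := resolventForm 0 1 ζ Exp.one Exp.one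

lemma continuous_dispersion : Continuous dispersion :=
  continuous_resolventForm 0 one_pos Exp.one Exp.one

/-- The line at height 1 stays at distance at least 1 from the pole throughout Re ζ ≥ 0, so
estimates are uniform up to and including the imaginary axis. -/
lemma dispersion_eq {ζ : ℂ} (hζ : -1 < ζ.re) :
    dispersion ζ = ∫ u : ℝ, (ζ + 1 - I * u)⁻¹ * gauss 0 1 (u + I) := by
  rw [dispersion, resolventForm_eq_shiftedCauchyForm 0 one_pos one_pos hζ,
    shiftedCauchyForm_one 0 1 zero_le_one]
  simp

/-- Scaling of the dispersion function. -/
lemma resolventForm_one_eq_dispersion (ω₀ : ℝ) {s : ℝ} (hs : 0 < s) {z : ℂ} (hz : 0 ≤ z.re) :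
    resolventForm ω₀ (s ^ 2) z Exp.one Exp.one = s * dispersion (s * (z - I * ω₀)) := by
  have hs0 : (s : ℂ) ≠ 0 := by exact_mod_cast hs.ne'
  have hsi : 0 < s⁻¹ := inv_pos.2 hs
  have hre : -1 < ((s : ℂ) * (z - I * ω₀)).re := by
    have : 0 ≤ s * z.re := mul_nonneg hs.le hz
    simp
    linarith
  -- The substitution u = s(ω − ω₀) carries height s⁻¹ to height 1, the one used for the dispersion
  -- function.
  rw [resolventForm_eq_shiftedCauchyForm ω₀ (pow_pos hs 2) hsi (by linarith),
    shiftedCauchyForm_one _ _ hsi.le, dispersion_eq hre]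
  set G : ℝ → ℂ := fun u => ((s : ℂ) * (z - I * ω₀) + 1 - I * u)⁻¹ * gauss 0 1 (u + I) with hG
  have h1 : ∫ u : ℝ, G (s * u) = (s : ℂ)⁻¹ * ∫ u : ℝ, G u := by
    rw [Measure.integral_comp_mul_left G, abs_of_pos hsi, real_smul, ofReal_inv]
  have h2 : ∫ u : ℝ, G u = s * ∫ u : ℝ, G (s * u) := by
    rw [h1, ← mul_assoc, mul_inv_cancel₀ hs0, one_mul]
  rw [h2, ← mul_assoc, ← integral_const_mul, ← integral_add_right_eq_self _ ω₀]
  congr 1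
  funext u
  simp only [hG, gauss]
  have e1 : (s : ℂ) * (z - I * ω₀) + 1 - I * ((s * u : ℝ) : ℂ)
      = s * (z + (s⁻¹ : ℝ) - I * ((u + ω₀ : ℝ) : ℂ)) := by
    push_cast
    field_simp
    ring
  have e2 : Real.sqrt (s ^ 2 / Real.pi) = s * Real.sqrt (1 / Real.pi) := by
    rw [show s ^ 2 / Real.pi = s ^ 2 * (1 / Real.pi) by ring, Real.sqrt_mul (by positivity),
      Real.sqrt_sq hs.le]
  have e3 : -((s ^ 2 : ℝ) : ℂ) * (((u + ω₀ : ℝ) : ℂ) + (s⁻¹ : ℝ) * I - ω₀) ^ 2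
      = -((1 : ℝ) : ℂ) * (((s * u : ℝ) : ℂ) + I - (0 : ℝ)) ^ 2 := by
    push_cast
    field_simp
    ring
  rw [e1, e2, e3, mul_inv]
  push_cast
  field_simp

/-! ### Asymptotics of the dispersion function -/

lemma integral_gauss_add_I : ∫ u : ℝ, gauss 0 1 (u + I) = 1 := by
  have h1 := GaussianFourier.integral_cexp_neg_mul_sq_add_real_mul_I (b := 1) (by simp) 1
  have h2 : ∀ u : ℝ, gauss 0 1 (u + I)
      = (Real.sqrt (1 / Real.pi) : ℂ) * Complex.exp (-1 * (u + (1 : ℝ) * I) ^ 2) := by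
    intro u
    simp [gauss]
  simp_rw [h2]
  rw [integral_const_mul, h1, div_one, ← Complex.ofReal_one, ← Complex.ofReal_ofNat,
    ← Complex.ofReal_div, ← Complex.ofReal_cpow Real.pi_pos.le, ← Real.sqrt_eq_rpow,
    ← Complex.ofReal_mul, ← Real.sqrt_mul (by positivity), one_div_mul_cancel Real.pi_ne_zero,
    Real.sqrt_one]

lemma integrable_exp_mul_norm_gauss_add_I (B : ℝ) :
    Integrable fun u : ℝ => Real.exp (B * |u|) * ‖gauss 0 1 (u + I)‖ := by
  refine ((integrable_weight 0 one_pos B).const_mul (Real.exp 1)).congr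
    (Eventually.of_forall fun u => ?_)
  have h1 := norm_gauss 0 1 u 1
  have h2 := norm_gauss 0 1 u 0
  simp only [ofReal_one, one_mul, ofReal_zero, zero_mul, add_zero] at h1 h2
  simp only [h1, h2]
  norm_num
  ring

lemma one_le_norm_kernel {ζ : ℂ} (hζ : 0 ≤ ζ.re) (u : ℝ) : 1 ≤ ‖ζ + 1 - I * u‖ := by
  have := (le_abs_self _).trans (Complex.abs_re_le_norm (ζ + 1 - I * u))
  simp at this
  linarith

/-- The Gaussian has total integral 1 on the shifted line too, so ζD(ζ) − 1 is the integral of (iu −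
1)/(ζ + 1 − iu) against it. The denominator is traded for ζ + 1 at the cost of a factor 1 + |u|, and
(1 + |u|)² ≤ e^{2|u|} is absorbed by the Gaussian. -/
lemma norm_mul_dispersion_sub_one_le :
    ∃ C : ℝ, 0 ≤ C ∧ ∀ ζ : ℂ, 0 ≤ ζ.re → ‖ζ * dispersion ζ - 1‖ ≤ C / ‖ζ + 1‖ := by
  have hmeas : AEStronglyMeasurable fun u : ℝ => gauss 0 1 (u + I) :=
    ((gauss_continuous 0 1).comp (by fun_prop : Continuous fun u : ℝ => (u : ℂ) + I)
      ).aestronglyMeasurable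
  have hint : Integrable fun u : ℝ => gauss 0 1 (u + I) := by
    refine (integrable_exp_mul_norm_gauss_add_I 0).mono' hmeas (Eventually.of_forall fun u => ?_)
    simp
  refine ⟨∫ u : ℝ, Real.exp (2 * |u|) * ‖gauss 0 1 (u + I)‖,
    integral_nonneg fun u => by positivity, fun ζ hζ => ?_⟩
  have hk : Integrable fun u : ℝ => (ζ + 1 - I * u)⁻¹ * gauss 0 1 (u + I) := by
    refine hint.bdd_mul (c := 1) ?_ (Eventually.of_forall fun u => ?_)
    · exact (by fun_prop : Measurable fun u : ℝ => (ζ + 1 - I * u)⁻¹).aestronglyMeasurable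
    · rw [norm_inv]
      exact inv_le_one_of_one_le₀ (one_le_norm_kernel hζ u)
  have e : ζ * dispersion ζ - 1
      = ∫ u : ℝ, (ζ * ((ζ + 1 - I * u)⁻¹ * gauss 0 1 (u + I)) - gauss 0 1 (u + I)) := by
    rw [integral_sub (hk.const_mul ζ) hint, integral_const_mul, integral_gauss_add_I,
      dispersion_eq (by linarith)]
  rw [e, div_eq_mul_inv, mul_comm, ← integral_const_mul]
  refine norm_integral_le_of_norm_le ((integrable_exp_mul_norm_gauss_add_I 2).const_mul _)
    (Eventually.of_forall fun u => ?_)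
  have h1 := one_le_norm_kernel hζ u
  have hne : ζ + 1 - I * u ≠ 0 := norm_pos_iff.1 (one_pos.trans_le h1)
  have hζ1 : 0 < ‖ζ + 1‖ := by
    have := one_le_norm_kernel hζ 0
    simp only [ofReal_zero, mul_zero, sub_zero] at this
    linarith
  have e1 : ζ * ((ζ + 1 - I * u)⁻¹ * gauss 0 1 (u + I)) - gauss 0 1 (u + I)
      = (I * u - 1) / (ζ + 1 - I * u) * gauss 0 1 (u + I) := by
    field_simp
    ring
  rw [e1, norm_mul, norm_div, ← mul_assoc]
  refine mul_le_mul_of_nonneg_right ?_ (norm_nonneg _)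
  have h2 : ‖I * u - 1‖ ≤ 1 + |u| := by
    refine (norm_sub_le _ _).trans (le_of_eq ?_)
    simp [add_comm]
  -- The triangle inequality gives ‖ζ + 1 − iu‖ + |u|, and the second term may be multiplied by ‖ζ +
  -- 1 − iu‖ ≥ 1.
  have h3 : ‖ζ + 1‖ ≤ (1 + |u|) * ‖ζ + 1 - I * u‖ := by
    have h4 : ‖ζ + 1‖ ≤ ‖ζ + 1 - I * u‖ + |u| := by
      have := norm_add_le (ζ + 1 - I * u) (I * u)
      simpa using this
    nlinarith [abs_nonneg u]
  have h5 : (1 + |u|) * (1 + |u|) ≤ Real.exp (2 * |u|) := by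
    have h6 := Real.add_one_le_exp |u|
    rw [two_mul, Real.exp_add]
    have := abs_nonneg u
    gcongr <;> linarith
  rw [inv_mul_eq_div, div_le_div_iff₀ (by linarith) hζ1]
  calc _ ≤ (1 + |u|) * ((1 + |u|) * ‖ζ + 1 - I * u‖) := by gcongr
    _ = ((1 + |u|) * (1 + |u|)) * ‖ζ + 1 - I * u‖ := by ring
    _ ≤ _ := by gcongr

/-! ### Absence of zeros in the closed right half-plane -/

lemma gauss_ofReal (ω₀ h x : ℝ) : gauss ω₀ h x
    = ((Real.sqrt (h / Real.pi) * Real.exp (-h * (x - ω₀) ^ 2) : ℝ) : ℂ) := by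
  rw [gauss]
  push_cast
  ring_nf

lemma cauchyForm_one (ζ : ℂ) :
    cauchyForm 0 1 ζ Exp.one Exp.one = ∫ ω : ℝ, (ζ - I * ω)⁻¹ * gauss 0 1 ω := by
  rw [cauchyForm]
  congr 1
  funext ω
  rw [Exp.ev_one (by simp), one_mul, one_mul]

/-- The kernel 1/(ζ − iω) has positive real part for Re ζ > 0 and is averaged against a positive
density. -/
lemma dispersion_re_pos {ζ : ℂ} (hζ : 0 < ζ.re) : 0 < (dispersion ζ).re := by
  rw [dispersion, resolventForm, if_pos hζ]
  have hi := integrable_cauchy 0 one_pos hζ.ne' Exp.one Exp.one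
  have h1 : ∀ ω : ℝ, 0 < ((ζ - I * ω)⁻¹ * (Exp.ev (ω : ℂ) Exp.one * Exp.ev (ω : ℂ) Exp.one
      * gauss 0 1 (ω : ℂ))).re := by
    intro ω
    rw [Exp.ev_one (by simp), one_mul, one_mul, gauss_ofReal, mul_comm, re_ofReal_mul, inv_re]
    have h2 : ζ - I * ω ≠ 0 := by
      intro h
      have := congrArg Complex.re h
      simp at this
      linarith
    have h3 := Complex.normSq_pos.2 h2
    have h4 : 0 < (ζ - I * ω).re := by simpa using hζ
    have := Real.pi_pos
    positivity
  rw [cauchyForm, ← RCLike.re_eq_complex_re, ← integral_re hi]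
  refine (integral_pos_iff_support_of_nonneg (fun ω => (h1 ω).le) hi.re).2 ?_
  have h2 : Function.support (fun ω : ℝ => ((ζ - I * ω)⁻¹ * (Exp.ev (ω : ℂ) Exp.one
      * Exp.ev (ω : ℂ) Exp.one * gauss 0 1 (ω : ℂ))).re) = univ :=
    eq_univ_of_forall fun ω => (h1 ω).ne'
  rw [h2]
  simp

/-- Reflection formula for the dispersion function. -/
lemma dispersion_reflect {ζ : ℂ} (hζ : 0 < ζ.re) :
    dispersion (-starRingEnd ℂ ζ) + starRingEnd ℂ (dispersion ζ)
      = 2 * Real.pi * gauss 0 1 (-starRingEnd ℂ ζ / I) := by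
  have hre : (-starRingEnd ℂ ζ).re < 0 := by simpa using hζ
  have him : 0 ≤ (-starRingEnd ℂ ζ / I).im := by
    rw [Complex.div_I]
    simpa using hζ.le
  rw [dispersion, dispersion, resolventForm, if_neg hre.le.not_gt, if_neg hre.ne, resolventForm,
    if_pos hζ, Exp.ev_one him, one_mul, one_mul, cauchyForm_one, cauchyForm_one, ← integral_conj]
  -- The conjugate kernel at ζ is the negative of the kernel at −ζ̄, so the Cauchy integrals cancel
  -- and only the residue term survives.
  have h1 : ∀ ω : ℝ, starRingEnd ℂ ((ζ - I * ω)⁻¹ * gauss 0 1 ω)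
      = -((-starRingEnd ℂ ζ - I * ω)⁻¹ * gauss 0 1 ω) := by
    intro ω
    rw [gauss_ofReal, map_mul, conj_ofReal, map_inv₀, map_sub, map_mul, conj_I, conj_ofReal,
      ← neg_mul, ← inv_neg]
    congr 2
    ring
  simp_rw [h1]
  rw [integral_neg]
  ring

/-- Inside the half-plane the real part is positive. On the axis −ζ̄ = ζ, so the limit of the
reflection formula reads 2 Re D(iy) = 2πg(y), which is nonzero. -/
lemma dispersion_ne_zero {ζ : ℂ} (hζ : 0 ≤ ζ.re) : dispersion ζ ≠ 0 := by
  rcases hζ.eq_or_lt with h0 | h0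
  · intro hd
    have hc1 : Continuous fun x : ℝ => dispersion (-starRingEnd ℂ (ζ + x))
        + starRingEnd ℂ (dispersion (ζ + x)) := by
      have := continuous_dispersion
      exact (this.comp (by fun_prop)).add (Complex.continuous_conj.comp (this.comp (by fun_prop)))
    have hc2 : Continuous fun x : ℝ =>
        2 * (Real.pi : ℂ) * gauss 0 1 (-starRingEnd ℂ (ζ + x) / I) :=
      continuous_const.mul ((gauss_continuous 0 1).comp (by fun_prop))
    have key := tendsto_nhds_unique_of_eventuallyEq
      ((hc1.tendsto 0).mono_left (nhdsWithin_le_nhds (s := Ioi 0)))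
      ((hc2.tendsto 0).mono_left (nhdsWithin_le_nhds (s := Ioi 0)))
      (by
        filter_upwards [self_mem_nhdsWithin] with x hx
        exact dispersion_reflect (by simpa [← h0] using hx))
    have e : -starRingEnd ℂ ζ = ζ := by
      apply Complex.ext <;> simp [← h0]
    simp only [ofReal_zero, add_zero, e, hd, map_zero] at key
    have hpi : (Real.pi : ℂ) ≠ 0 := by exact_mod_cast Real.pi_ne_zero
    have hsq : (Real.sqrt (1 / Real.pi) : ℂ) ≠ 0 := by
      exact_mod_cast (Real.sqrt_pos.2 (one_div_pos.2 Real.pi_pos)).ne'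
    exact mul_ne_zero (mul_ne_zero two_ne_zero hpi)
      (mul_ne_zero hsq (Complex.exp_ne_zero _)) key.symm
  · intro h
    have := dispersion_re_pos h0
    rw [h] at this
    simp at this

lemma exists_lower_bound_dispersion (R : ℝ) :
    ∃ m, 0 < m ∧ ∀ ζ : ℂ, 0 ≤ ζ.re → ‖ζ‖ ≤ R → m ≤ ‖dispersion ζ‖ := by
  have hK : IsCompact (Metric.closedBall (0 : ℂ) R ∩ {ζ : ℂ | 0 ≤ ζ.re}) :=
    (isCompact_closedBall _ _).inter_right (isClosed_le continuous_const Complex.continuous_re)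
  obtain ⟨m, hm, hmb⟩ := hK.exists_forall_le' continuous_dispersion.norm.continuousOn
    (fun ζ hζ => norm_pos_iff.2 (dispersion_ne_zero hζ.2))
  exact ⟨m, hm, fun ζ h1 h2 => hmb ζ ⟨by simpa using h2, h1⟩⟩

/-! ## Stability below the critical coupling -/

/-- Equal cosines mean a ≡ ±θ modulo 2π, so the worst case for cos(a + t) is cos(θ − |t|). The
hypotheses keep θ − |t| in [π/2 + d, π], where cosine is at most −sin d. -/
lemma cos_add_le_neg_sin {θ a t r d : ℝ} (hθ : θ ≤ Real.pi) (ha : Real.cos a = Real.cos θ)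
    (hr : Real.pi / 2 + r + 2 * d ≤ θ) (hd : 0 ≤ d) (ht : |t| ≤ r + d) :
    Real.cos (a + t) ≤ -Real.sin d := by
  have hpi := Real.pi_pos
  have ht0 := abs_nonneg t
  have hθ0 : 0 ≤ θ := by linarith
  have h1 : |Real.sin a| = Real.sin θ := by
    rw [← abs_of_nonneg (Real.sin_nonneg_of_nonneg_of_le_pi hθ0 hθ), ← sq_eq_sq_iff_abs_eq_abs,
      Real.sin_sq, Real.sin_sq, ha]
  have h2 : Real.sin |t| = |Real.sin t| :=
    (Real.abs_sin_eq_sin_abs_of_abs_le_pi (by linarith)).symm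
  have h3 : -(Real.sin a * Real.sin t) ≤ Real.sin θ * Real.sin |t| := by
    rw [h2, ← h1, ← abs_mul]
    exact neg_le_abs _
  have h4 : Real.cos (a + t) ≤ Real.cos (θ - |t|) := by
    rw [Real.cos_add, Real.cos_sub, Real.cos_abs, ha]
    linarith
  refine h4.trans ?_
  rw [← Real.cos_add_pi_div_two]
  exact Real.cos_le_cos_of_nonneg_of_le_pi (by linarith) (by linarith) (by linarith)

/-- With θ = arccos(cos ω₀τ) one has k_c τ = 2θ − π. The bound on |k| thus says that θ is farther
than |k|τ/2 from π/2, and the sign condition says on which side; the leftover margin is d. -/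
lemma exists_mul_cos_le {k ω₀ τ : ℝ} (hτ : 0 < τ) (hk0 : k ≠ 0)
    (hk : |k| < |criticalCoupling ω₀ τ|) (hsign : 0 ≤ k * criticalCoupling ω₀ τ) :
    ∃ d, 0 < d ∧ 0 < Real.sin d ∧ ∀ t, |t| ≤ |k| / 2 * τ + d →
      k * Real.cos (ω₀ * τ + t) ≤ -(|k| * Real.sin d) := by
  have hpi := Real.pi_pos
  set θ := Real.arccos (Real.cos (ω₀ * τ)) with hθ
  have hθ0 : 0 ≤ θ := Real.arccos_nonneg _
  have hθpi : θ ≤ Real.pi := Real.arccos_le_pi _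
  have hcos : Real.cos (ω₀ * τ) = Real.cos θ :=
    (Real.cos_arccos (Real.neg_one_le_cos _) (Real.cos_le_one _)).symm
  have hkc : criticalCoupling ω₀ τ * τ = 2 * θ - Real.pi := by
    rw [criticalCoupling, ← hθ]
    field_simp
  have hlt : |k| * τ < |2 * θ - Real.pi| := by
    rw [← hkc, abs_mul, abs_of_pos hτ]
    exact mul_lt_mul_of_pos_right hk hτ
  have hsign' : 0 ≤ k * (2 * θ - Real.pi) := by
    rw [← hkc, ← mul_assoc]
    exact mul_nonneg hsign hτ.le
  have hkτ : 0 ≤ |k| * τ := by positivity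
  -- A quarter of the gap turns π/2 + |k|τ/2 + 2d ≤ θ, required by `cos_add_le_neg_sin`, into an
  -- equality when k > 0.
  set d := (|2 * θ - Real.pi| - |k| * τ) / 4 with hd
  have hd0 : 0 < d := by rw [hd]; linarith
  have habs : |2 * θ - Real.pi| ≤ Real.pi := abs_le.2 ⟨by linarith, by linarith⟩
  refine ⟨d, hd0, Real.sin_pos_of_pos_of_lt_pi hd0 (by linarith), fun t ht => ?_⟩
  rcases lt_or_gt_of_ne hk0 with hneg | hpos
  · have h1 : 2 * θ - Real.pi ≤ 0 := by
      by_contra! h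
      nlinarith
    rw [abs_of_nonpos h1] at hd
    -- For k < 0 the angle lies below π/2. Shifting by π changes the sign of the cosine and reflects
    -- θ to π − θ.
    have h2 := cos_add_le_neg_sin (θ := Real.pi - θ) (a := ω₀ * τ + Real.pi) (t := t)
      (r := |k| / 2 * τ) (d := d) (by linarith)
      (by rw [Real.cos_add_pi, Real.cos_pi_sub, hcos]) (by linarith) hd0.le ht
    rw [add_right_comm, Real.cos_add_pi] at h2
    rw [abs_of_neg hneg]
    nlinarith
  · have h1 : 0 ≤ 2 * θ - Real.pi := by
      by_contra! h
      nlinarith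
    rw [abs_of_nonneg h1] at hd
    have h2 := cos_add_le_neg_sin (θ := θ) (a := ω₀ * τ) (t := t)
      (r := |k| / 2 * τ) (d := d) hθpi hcos (by linarith) hd0.le ht
    rw [abs_of_pos hpos]
    nlinarith

lemma exists_forall_pointSpectrumKM_re_neg {k ω₀ τ : ℝ} (hτ : 0 < τ)
    (hk : |k| < |criticalCoupling ω₀ τ|) (hsign : 0 ≤ k * criticalCoupling ω₀ τ) :
    ∃ hstar : ℝ, 0 < hstar ∧ ∀ (h : ℝ) (hh : 0 < h), hstar < h →
      ∀ z ∈ pointSpectrumKM k ω₀ τ hh, z.re < 0 := by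
  rcases eq_or_ne k 0 with rfl | hk0
  · refine ⟨1, one_pos, fun h hh _ z hz => ?_⟩
    rw [mem_pointSpectrumKM_iff] at hz
    simp at hz
  obtain ⟨d, hd, hsin, hcos⟩ := exists_mul_cos_le hτ hk0 hk hsign
  obtain ⟨C, hC0, hC⟩ := norm_mul_dispersion_sub_one_le
  have hkpos : 0 < |k| := abs_pos.2 hk0
  -- ε bounds |ζD(ζ) − 1| far out. The first condition keeps the resulting change of phase within d,
  -- the second lets −sin d dominate the error in the real part.
  obtain ⟨ε, hε, hεd, hεs⟩ : ∃ ε : ℝ, 0 < ε ∧ |k| / 2 * τ * ε ≤ d ∧ ε < Real.sin d := by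
    refine ⟨min (d / (|k| / 2 * τ)) (Real.sin d / 2), by positivity, ?_, ?_⟩
    · calc _ ≤ |k| / 2 * τ * (d / (|k| / 2 * τ)) := by gcongr; exact min_le_left _ _
        _ = d := by field_simp
    · exact (min_le_right _ _).trans_lt (by linarith)
  set R := C / ε + 1 with hR
  have hR0 : 0 < R := by positivity
  have hfar : ∀ ζ : ℂ, 0 ≤ ζ.re → R < ‖ζ‖ → ‖ζ * dispersion ζ - 1‖ ≤ ε := by
    intro ζ hζ hζR
    have h1 : ‖ζ‖ ≤ ‖ζ + 1‖ := by
      refine (sq_le_sq₀ (norm_nonneg _) (norm_nonneg _)).1 ?_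
      rw [Complex.sq_norm, Complex.sq_norm, Complex.normSq_apply, Complex.normSq_apply]
      simp
      nlinarith
    refine (hC ζ hζ).trans ((div_le_iff₀ (by linarith)).2 ?_)
    have h2 : C = ε * (C / ε) := by field_simp
    rw [h2]
    gcongr
    linarith
  obtain ⟨m, hm, hnear⟩ := exists_lower_bound_dispersion R
  -- Threshold for the near regime: (|k|/2)e^{−Rτ}·S·m = 1. The choice h* = 1 + S² below then yields
  -- both s > S and s ≥ 1.
  set S := 2 * Real.exp (R * τ) / (|k| * m) with hS
  have hS0 : 0 < S := by positivity
  refine ⟨1 + S ^ 2, by positivity, fun h hh hlarge z hz => ?_⟩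
  by_contra! hre
  rw [mem_pointSpectrumKM_iff] at hz
  set s := Real.sqrt h with hs
  have hs0 : 0 < s := Real.sqrt_pos.2 hh
  have hsq : h = s ^ 2 := (Real.sq_sqrt hh.le).symm
  have hs1 : 1 ≤ s := by nlinarith [sq_nonneg S]
  have hsS : S < s := by nlinarith
  rw [hsq, resolventForm_one_eq_dispersion ω₀ hs0 hre] at hz
  set lam : ℂ := z - I * ω₀ with hlam
  have hlre : lam.re = z.re := by simp [hlam]
  have hlim : lam.im = z.im - ω₀ := by simp [hlam]
  have hζre : ((s : ℂ) * lam).re = s * z.re := by rw [re_ofReal_mul, hlre]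
  have hζ0 : 0 ≤ ((s : ℂ) * lam).re := by rw [hζre]; positivity
  set v : ℂ := ((k / 2 : ℝ) : ℂ) * Complex.exp (-(z * τ)) with hv
  have hvn : ‖v‖ = |k| / 2 * Real.exp (-(z.re * τ)) := by
    rw [hv, norm_mul, Complex.norm_real, Complex.norm_exp, Real.norm_eq_abs, abs_div]
    simp
  -- In the disc, s ≥ 1 gives Re z ≤ R, so |v| cannot be small and |v·s·D| exceeds 1. Outside it,
  -- the asymptotics of D apply.
  rcases le_or_gt ‖(s : ℂ) * lam‖ R with hle | hgt
  · have h1 := hnear _ hζ0 hle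
    have h2 : z.re ≤ R := by
      have h3 := (Complex.re_le_norm ((s : ℂ) * lam)).trans hle
      rw [hζre] at h3
      nlinarith
    have h3 := congrArg norm hz
    rw [norm_mul v, norm_mul (s : ℂ), hvn, Complex.norm_real, Real.norm_eq_abs, abs_of_pos hs0,
      norm_one] at h3
    have h4 : Real.exp (-(R * τ)) ≤ Real.exp (-(z.re * τ)) := by gcongr
    have h5 : |k| / 2 * Real.exp (-(R * τ)) * (s * m) ≤ 1 := by
      rw [← h3]
      gcongr
    have h6 : 1 < |k| / 2 * Real.exp (-(R * τ)) * (s * m) := by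
      calc 1 = |k| / 2 * Real.exp (-(R * τ)) * (S * m) := by
            rw [hS, Real.exp_neg]
            field_simp
        _ < _ := by gcongr
    linarith
  · have h1 := hfar _ hζ0 hgt
    set E : ℂ := (s : ℂ) * lam * dispersion (s * lam) with hE
    -- The eigenvalue equation multiplied by λ: up to the factor E ≈ 1 this is the scalar delay
    -- equation λ = v.
    have hlE : lam = v * E := by
      rw [hE]
      linear_combination (-lam) * hz
    have hvle : ‖v‖ ≤ |k| / 2 := by
      rw [hvn]
      refine mul_le_of_le_one_right (by positivity) (Real.exp_le_one_iff.2 ?_)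
      have := mul_nonneg hre hτ.le
      linarith
    have hEn : ‖E‖ ≤ 1 + ε := by
      have := norm_add_le (E - 1) 1
      rw [sub_add_cancel, norm_one] at this
      linarith
    have hln : ‖lam‖ ≤ |k| / 2 * (1 + ε) := by
      rw [hlE, norm_mul]
      gcongr
    have ht : |lam.im * τ| ≤ |k| / 2 * τ + d := by
      rw [abs_mul, abs_of_pos hτ]
      calc _ ≤ |k| / 2 * (1 + ε) * τ := by
            gcongr
            exact (Complex.abs_im_le_norm _).trans hln
        _ = |k| / 2 * τ + |k| / 2 * τ * ε := by ring
        _ ≤ _ := by gcongr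
    have hvre : v.re = Real.exp (-(z.re * τ)) / 2 * (k * Real.cos (ω₀ * τ + lam.im * τ)) := by
      have e : ω₀ * τ + lam.im * τ = z.im * τ := by rw [hlim]; ring
      rw [hv, re_ofReal_mul, Complex.exp_re, e]
      simp
      ring
    have hvre' : v.re ≤ -(‖v‖ * Real.sin d) := by
      rw [hvre, hvn]
      calc _ ≤ Real.exp (-(z.re * τ)) / 2 * (-(|k| * Real.sin d)) := by
            gcongr
            exact hcos _ ht
        _ = _ := by ring
    have hvpos : 0 < ‖v‖ := by rw [hvn]; positivity
    -- Together with Re v ≤ −‖v‖ sin d this gives Re λ ≤ ‖v‖(ε − sin d) < 0, whereas Re λ = Re z ≥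
    -- 0.
    have hre2 : lam.re ≤ v.re + ‖v‖ * ε := by
      have e : lam = v + v * (E - 1) := by rw [hlE]; ring
      have h2 : (v * (E - 1)).re ≤ ‖v‖ * ε := by
        refine (Complex.re_le_norm _).trans ?_
        rw [norm_mul]
        gcongr
      calc lam.re = v.re + (v * (E - 1)).re := by rw [← add_re, ← e]
        _ ≤ _ := by gcongr
    nlinarith

end DelayedKuramoto

/-- Generalized spectrum of the delayed Kuramoto linearization with Gaussian frequency density.
(a) The generalized spectrum consists of generalized eigenvalues only, and the generalized continuous
and residual spectra are empty.  (b) If `k` lies between `0` and the critical coupling `k_c(τ)`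
(`|k| < |k_c(τ)|`, and `k` is not of the opposite sign), then for all large `h` every generalized
eigenvalue has negative real part. -/
theorem theorem4 :
    (∀ (k ω₀ τ h : ℝ) (_hτ : 0 ≤ τ) (hh : 0 < h),
      DelayedKuramoto.spectrumKM k ω₀ τ hh = DelayedKuramoto.pointSpectrumKM k ω₀ τ hh ∧
      DelayedKuramoto.continuousSpectrumKM k ω₀ τ hh = ∅ ∧
      DelayedKuramoto.residualSpectrumKM k ω₀ τ hh = ∅) ∧
    (∀ (k ω₀ τ : ℝ), 0 < τ → ω₀ ≠ 0 →
      |k| < |DelayedKuramoto.criticalCoupling ω₀ τ| →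
      0 ≤ k * DelayedKuramoto.criticalCoupling ω₀ τ →
      ∃ hstar : ℝ, 0 < hstar ∧ ∀ (h : ℝ) (hh : 0 < h), hstar < h →
        ∀ z ∈ DelayedKuramoto.pointSpectrumKM k ω₀ τ hh, z.re < 0) := by
  refine ⟨fun k ω₀ τ h _ hh => ⟨DelayedKuramoto.spectrumKM_eq k ω₀ τ hh,
    DelayedKuramoto.continuousSpectrumKM_eq_empty k ω₀ τ hh,
    DelayedKuramoto.residualSpectrumKM_eq_empty k ω₀ τ hh⟩, fun k ω₀ τ hτ _ hk hsign =>
    DelayedKuramoto.exists_forall_pointSpectrumKM_re_neg hτ hk hsign⟩
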